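/- Let $\mathcal X$ be a measurable space and $\mathcal Y=\{0,1\}$. For a probability distribution $P$ on $\mathcal X\times\mathcal Y$ with marginal $P_X$ on $\mathcal X$, a classifier $f:\mathcal X\to\mathcal Y$ and a class $\mathcal H$ of (measurable) classifiers, write $R_P(f)=P(f(X)\neq Y)$ and $R_{P,\mathcal H}=\inf_{h\in\mathcal H}R_P(h)$. For a set $\mathcal P$ of probability distributions on $\mathcal X\times\mathcal Y$ and $\ell\ge 1$ define the minimax expected excess risks $$L(\ell)=\inf_{A}\ \sup_{P\in\mathcal P}\ \mathbb E_{S\sim P^\ell}\bigl(R_P(A(S))-R_{P,\mathcal H}\bigr)_+,\qquad L^{\mathrm{mar}}(\ell)=\inf_{A}\ \sup_{P\in\mathcal P}\ \mathbb E_{S\sim P^\ell}\bigl(R_P(A(S,P_X))-R_{P,\mathcal H}\bigr)_+,$$ where the first infimum is over all maps $A$ from samples in $(\mathcal X\times\mathcal Y)^\ell$ to classifiers, and the second over all maps that receive the marginal $P_X$ as an additional input (expectations of non-measurable quantities are upper expectations). *Knowing the marginal helps* to learn $\mathcal H$ over $\mathcal P$ if $\lim_{\ell\to\infty}L^{\mathrm{mar}}(\ell)/L(\ell)=0$.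 Call $\mathcal P$ *rich* for $\mathcal H$ if there are $h,h'\in\mathcal H$ and a probability distribution $\mu$ on $\mathcal X$ with $$\mu(\{x: h(x)\ne h'(x),\ h(x)=0\})\neq\mu(\{x: h(x)\ne h'(x),\ h(x)=1\})$$ such that for every $\alpha\in(0,\tfrac12)$ the set $\mathcal P$ contains the distributions $P_\alpha$ and $P_{-\alpha}$ with marginal $\mu$ and labeling functions $P_{\pm\alpha}(Y=1\mid X=x)=\tfrac12\pm\alpha$ where $h(x)\neq h'(x)$, and $=h(x)$ where $h(x)=h'(x)$. **Theorem.** Let $\mathcal H$ have finite VC dimension and let $\mathcal P$ be rich for $\mathcal H$. Assume the usual measurability of the class: for all $P\in\mathcal P$, $n\in\mathbb N$ and $b\in\{0,1\}^n$, the set of $(x_1,\dots,x_n)\in\mathcal X^n$ such that $(h(x_1),\dots,h(x_n))=b$ for some $h\in\mathcal H$ is measurable for the completion of $P_X^n$ (this holds e.g. if $\mathcal H$ is countable). Then knowing the marginal does not help to learn $\mathcal H$ over $\mathcal P$. More precisely, both $L(\ell)$ and $L^{\mathrm{mar}}(\ell)$ are of order $1/\sqrt\ell$: there are constants $c_1,c_2>0$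 (depending on $\mathcal H$ and $\mathcal P$) such that $c_1/\sqrt\ell\le L^{\mathrm{mar}}(\ell)\le L(\ell)\le c_2/\sqrt\ell$ for all $\ell\ge1$. -/

import Mathlib

open MeasureTheory
open scoped ENNReal

namespace SSL

noncomputable section

/-- The finite set `s` is shattered by the class `H` of classifiers `X → Bool`
(labels: `false` is `0`, `true` is `1`). -/
def Shatters {X : Type*} (H : Set (X → Bool)) (s : Finset X) : Prop :=
  ∀ t : Finset X, t ⊆ s → ∃ h ∈ H, ∀ x ∈ s, (h x = true ↔ x ∈ t)

/-- The VC dimension of `H` is finite: the cardinalities of shattered sets are bounded. -/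
def FiniteVCDim {X : Type*} (H : Set (X → Bool)) : Prop :=
  ∃ d : ℕ, ∀ s : Finset X, Shatters H s → s.card ≤ d

variable {X : Type*} [MeasurableSpace X]

/-- The usual measurability requirement on a possibly uncountable class `H` under the marginal `μ`:
for every `n` and every label pattern `b`, the set of points `(x₁, …, xₙ)` on which some member of
`H` realizes `b` is measurable with respect to the completion of `μⁿ`. (Equivalently, the suprema
over `h ∈ H` of the sums `∑ eᵢ h(xᵢ)` are measurable with respect to that completion.) It holds for
every countable class of measurable classifiers. -/
def IsMeasurableClass (H : Set (X → Bool)) (μ : Measure X) : Prop :=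
  ∀ (n : ℕ) (b : Fin n → Bool),
    NullMeasurableSet {x : Fin n → X | ∃ h ∈ H, ∀ i, h (x i) = b i} (Measure.pi fun _ => μ)

/-- The risk `P(f(X) ≠ Y)`. -/
def risk (P : ProbabilityMeasure (X × Bool)) (f : X → Bool) : ℝ≥0∞ :=
  (P : Measure (X × Bool)) {p | f p.1 ≠ p.2}

/-- The minimal risk over the class `H`. -/
def bestRisk (P : ProbabilityMeasure (X × Bool)) (H : Set (X → Bool)) : ℝ≥0∞ :=
  ⨅ h ∈ H, risk P h

/-- The positive part of the excess risk (subtraction in `ℝ≥0∞` is truncated at zero). -/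
def excessRisk (P : ProbabilityMeasure (X × Bool)) (H : Set (X → Bool)) (f : X → Bool) : ℝ≥0∞ :=
  risk P f - bestRisk P H

/-- The marginal on the feature space. -/
def marginal (P : ProbabilityMeasure (X × Bool)) : Measure X :=
  (P : Measure (X × Bool)).fst

/-- The law of an i.i.d. labeled sample of size `ℓ`. -/
def sampleLaw (P : ProbabilityMeasure (X × Bool)) (ℓ : ℕ) : Measure (Fin ℓ → X × Bool) :=
  Measure.pi fun _ => (P : Measure (X × Bool))

/-- The (upper) expectation of a nonnegative quantity. It is `∫⁻ f ∂μ` for measurable `f`; since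
learning algorithms are arbitrary maps, their risk need not depend measurably on the sample. -/
def expectation {Ω : Type*} [MeasurableSpace Ω] (μ : Measure Ω) (f : Ω → ℝ≥0∞) : ℝ≥0∞ :=
  ⨅ (g : Ω → ℝ≥0∞) (_ : Measurable g) (_ : ∀ ω, f ω ≤ g ω), ∫⁻ ω, g ω ∂μ

/-- A supervised algorithm: for each `ℓ`, a map from labeled samples of size `ℓ` to classifiers. -/
abbrev SLAlgorithm (X : Type*) : Type _ :=
  ∀ ℓ : ℕ, (Fin ℓ → X × Bool) → (X → Bool)

/-- An algorithm that receives the marginal distribution in addition to the labeled sample. -/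
abbrev MarginalAlgorithm (X : Type*) [MeasurableSpace X] : Type _ :=
  ∀ ℓ : ℕ, (Fin ℓ → X × Bool) → Measure X → (X → Bool)

/-- The minimax expected excess risk of supervised learning. -/
def minimaxSL (H : Set (X → Bool)) (𝓟 : Set (ProbabilityMeasure (X × Bool))) (ℓ : ℕ) : ℝ≥0∞ :=
  ⨅ A : SLAlgorithm X, ⨆ P ∈ 𝓟, expectation (sampleLaw P ℓ) fun S => excessRisk P H (A ℓ S)

/-- The minimax expected excess risk of learners that are given the marginal. -/
def minimaxMarginal (H : Set (X → Bool)) (𝓟 : Set (ProbabilityMeasure (X × Bool))) (ℓ : ℕ) :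
    ℝ≥0∞ :=
  ⨅ A : MarginalAlgorithm X, ⨆ P ∈ 𝓟,
    expectation (sampleLaw P ℓ) fun S => excessRisk P H (A ℓ S (marginal P))

/-- Knowing the marginal helps to learn `H` over `𝓟`. -/
def MarginalHelps (H : Set (X → Bool)) (𝓟 : Set (ProbabilityMeasure (X × Bool))) : Prop :=
  Filter.Tendsto (fun ℓ : ℕ => minimaxMarginal H 𝓟 ℓ / minimaxSL H 𝓟 ℓ) Filter.atTop (nhds 0)

/-- `f` has rate `g`, for sample sizes `ℓ ≥ 1`. -/
def HasRate (f : ℕ → ℝ≥0∞) (g : ℕ → ℝ) : Prop :=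
  ∃ c₁ c₂ : ℝ, 0 < c₁ ∧ 0 < c₂ ∧ ∀ ℓ : ℕ, 1 ≤ ℓ →
    ENNReal.ofReal (c₁ * g ℓ) ≤ f ℓ ∧ f ℓ ≤ ENNReal.ofReal (c₂ * g ℓ)

/-- `P` consists of the marginal `μ` paired with the labeling function `η = P(Y = 1 | X = ·)`. -/
def IsPairing (P : ProbabilityMeasure (X × Bool)) (μ : Measure X) (η : X → ℝ) : Prop :=
  marginal P = μ ∧ ∀ B : Set X, MeasurableSet B →
    (P : Measure (X × Bool)) (B ×ˢ {true}) = ∫⁻ x in B, ENNReal.ofReal (η x) ∂μ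

/-- The labeling function that equals `1/2 + α` where `h ≠ h'` and agrees with `h` elsewhere. -/
def richLabeling {X : Type*} (h h' : X → Bool) (α : ℝ) (x : X) : ℝ :=
  if h x ≠ h' x then 1 / 2 + α else if h x = true then 1 else 0

/-- The family `𝓟` is rich for the class `H`. -/
def IsRich (𝓟 : Set (ProbabilityMeasure (X × Bool))) (H : Set (X → Bool)) : Prop :=
  ∃ h ∈ H, ∃ h' ∈ H, ∃ μ : ProbabilityMeasure X,
    (μ : Measure X) {x | h x ≠ h' x ∧ h x = false} ≠
      (μ : Measure X) {x | h x ≠ h' x ∧ h x = true} ∧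
    ∀ α : ℝ, 0 < α → α < 1 / 2 →
      (∃ P ∈ 𝓟, IsPairing P μ (richLabeling h h' α)) ∧
      (∃ P ∈ 𝓟, IsPairing P μ (richLabeling h h' (-α)))

end

end SSL

open MeasureTheory
open scoped ENNReal

namespace SSL

/-! Upper bound. Empirical risk minimization has excess risk at most the mean largest surplus of
errors of a member of `H` on an independent ghost sample over its errors on the sample, divided by
`ℓ`. The joint law of sample and ghost sample is invariant under exchanging the `i`-th sample point
with the `i`-th ghost point, so for fixed points this surplus becomes the maximum of a random-sign
process indexed by the label patterns that `H` realizes on `2ℓ` points. Sauer's bound, applied to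
randomly chosen coordinates, shows that patterns at relative Hamming distance above `4⁻ʲ` number at
most `2 ^ (A * (j + 1))` (`card_packing_le`, `exists_packing_exponent`). Chaining over these scales
(`sum_selected_chaining_le`) gives a maximum of order `√ℓ` in mean, with no logarithmic factor.

Lower bound. The rich distributions with biases `α` and `-α` have the same marginal, so knowing it
does not distinguish them. Relative to the unbiased law their densities multiply to at least `1 -
4α²`. With `α` of order `1/√ℓ` the `ℓ`-fold products therefore overlap by a constant
(`two_point_lower_bound`). Every classifier has total excess risk at least `2αΔ` under the two laws,
where `Δ` is the difference of the two masses in the richness condition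
(`le_excessRisk_add_excessRisk`). Hence some law costs order `Δ/√ℓ`.

A learner may ignore the marginal, so both minimax values lie between these bounds and their ratio
stays away from zero. -/

/-! ### Maxima of random signed sums -/

/-- The sign attached to a Boolean. -/
noncomputable def boolSign (b : Bool) : ℝ := if b then 1 else -1

/-- The sign-weighted sum `∑ σᵢ vᵢ`. -/
noncomputable def signedSum {ι : Type*} [Fintype ι] (σ : ι → Bool) (v : ι → ℝ) : ℝ :=
  ∑ i, boolSign (σ i) * v i

theorem signedSum_sub {ι : Type*} [Fintype ι] (σ : ι → Bool) (v w : ι → ℝ) :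
    signedSum σ (fun i => v i - w i) = signedSum σ v - signedSum σ w := by
  simp only [signedSum, mul_sub, Finset.sum_sub_distrib]

/-- Independence of the signs factors the sum into terms `2 cosh (v i)`, and `cosh x ≤ exp (x² /
2)`: signed sums are sub-Gaussian. -/
theorem sum_exp_signedSum_le {ι : Type*} [Fintype ι] [DecidableEq ι] (v : ι → ℝ) :
    ∑ σ : ι → Bool, Real.exp (signedSum σ v)
      ≤ 2 ^ Fintype.card ι * Real.exp ((∑ i, v i ^ 2) / 2) := by
  have h1 : ∑ σ : ι → Bool, Real.exp (signedSum σ v) = ∏ i, (2 * Real.cosh (v i)) := by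
    have : ∀ i, 2 * Real.cosh (v i) = ∑ b : Bool, Real.exp (boolSign b * v i) := by
      intro i
      rw [Real.cosh_eq]
      simp [boolSign]
      ring
    simp_rw [this, Fintype.prod_sum, signedSum, Real.exp_sum]
  rw [h1, Finset.prod_mul_distrib, Finset.sum_div, Real.exp_sum]
  simp only [Finset.prod_const, Finset.card_univ]
  gcongr with i
  exact Real.cosh_le_exp_half_sq _

/-- Expectation of a maximum of finitely many signed sums, in terms of a selector `k`. The
coefficient `c σ ∈ {0, 1}` allows to replace the maximum by its positive part. -/
theorem sum_selected_signedSum_le {ι K : Type*} [Fintype ι] [DecidableEq ι] (s : Finset K)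
    (v : K → ι → ℝ) (k : (ι → Bool) → K) (c : (ι → Bool) → ℝ) (hc : ∀ σ, c σ = 0 ∨ c σ = 1)
    (hk : ∀ σ, k σ ∈ s) {r : ℝ} (hr : 0 < r) (hv : ∀ a ∈ s, ∑ i, v a i ^ 2 ≤ r ^ 2) :
    ∑ σ, c σ * signedSum σ (v (k σ))
      ≤ 2 ^ Fintype.card ι * (r * (Real.log (s.card + 1) + 1 / 2)) := by
  set n := Fintype.card ι
  set L : ℝ := Real.log (s.card + 1) + 1 / 2 with hL
  have hcard : Fintype.card (ι → Bool) = 2 ^ n := by simp [n]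
  -- Tangent bound `x + 1 ≤ exp x` at the selected value shifted by `L`, then the selected
  -- exponential is bounded by the sum over all of `s`. The extra summand `1` covers `c σ = 0`, and
  -- `L` is chosen so that the right side averages to at most `1`.
  have key : ∀ σ, c σ * signedSum σ (v (k σ)) / r - L + 1 ≤
      Real.exp (-L) * (1 + ∑ a ∈ s, Real.exp (signedSum σ (fun i => v a i / r))) := by
    intro σ
    refine (Real.add_one_le_exp _).trans ?_
    rw [sub_eq_neg_add, Real.exp_add]
    gcongr
    have hn : ∀ a ∈ s, 0 ≤ Real.exp (signedSum σ (fun i => v a i / r)) :=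
      fun a _ => (Real.exp_pos _).le
    rcases hc σ with h | h
    · rw [h]
      simp only [zero_mul, zero_div, Real.exp_zero]
      linarith [Finset.sum_nonneg hn]
    · have h2 := Finset.single_le_sum hn (hk σ)
      have h3 : c σ * signedSum σ (v (k σ)) / r = signedSum σ (fun i => v (k σ) i / r) := by
        simp only [h, one_mul, signedSum, Finset.sum_div, mul_div_assoc]
      rw [h3]
      linarith
  have hsum := Finset.sum_le_sum fun σ (_ : σ ∈ Finset.univ) => key σ
  rw [← Finset.mul_sum] at hsum
  simp only [Finset.sum_add_distrib, Finset.sum_sub_distrib, ← Finset.sum_div, Finset.sum_const,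
    Finset.card_univ, hcard, nsmul_eq_mul] at hsum
  rw [Finset.sum_comm] at hsum
  have hmom : ∑ a ∈ s, ∑ σ : ι → Bool, Real.exp (signedSum σ (fun i => v a i / r))
      ≤ ∑ _a ∈ s, 2 ^ n * Real.exp (1 / 2) := by
    refine Finset.sum_le_sum fun a ha => (sum_exp_signedSum_le _).trans ?_
    gcongr
    simp only [div_pow, ← Finset.sum_div]
    rw [div_le_one (by positivity)]
    exact hv a ha
  rw [Finset.sum_const, nsmul_eq_mul] at hmom
  have he : Real.exp (-L) * ((s.card + 1) * Real.exp (1 / 2)) = 1 := by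
    rw [hL, neg_add, Real.exp_add, Real.exp_neg, Real.exp_log (by positivity), Real.exp_neg]
    field_simp
  have h1 : (1 : ℝ) ≤ Real.exp (1 / 2) := Real.one_le_exp (by norm_num)
  have hfin : Real.exp (-L) * (((2 ^ n : ℕ) : ℝ) * 1 +
      ∑ a ∈ s, ∑ σ : ι → Bool, Real.exp (signedSum σ (fun i => v a i / r))) ≤ 2 ^ n := by
    calc _ ≤ Real.exp (-L) * (2 ^ n * Real.exp (1 / 2) + s.card * (2 ^ n * Real.exp (1 / 2))) := by
          push_cast
          gcongr
      _ = 2 ^ n * (Real.exp (-L) * ((s.card + 1) * Real.exp (1 / 2))) := by ring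
      _ = 2 ^ n := by rw [he, mul_one]
  have hfin2 := hsum.trans hfin
  push_cast at hfin2
  have : (∑ σ, c σ * signedSum σ (v (k σ))) / r ≤ 2 ^ n * L := by linarith
  rw [div_le_iff₀ hr] at this
  linarith

/-! ### Label patterns of a class of finite VC dimension -/

/-- Sauer's bound on the number of label patterns realized on `m` points. -/
theorem card_realized_le {X : Type*} {H : Set (X → Bool)} {d : ℕ}
    (hd : ∀ s : Finset X, Shatters H s → s.card ≤ d) {m : ℕ} (hm : 1 ≤ m) (x : Fin m → X)
    (F : Finset (Fin m → Bool)) (hF : ∀ u ∈ F, ∃ h ∈ H, ∀ i, h (x i) = u i) :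
    F.card ≤ (2 * m) ^ d := by
  classical
  let φ : (Fin m → Bool) → Finset (Fin m) := fun u => Finset.univ.filter fun i => u i = true
  have hφ : Function.Injective φ := by
    intro u w huw
    funext i
    have : i ∈ φ u ↔ i ∈ φ w := by rw [huw]
    simp only [φ, Finset.mem_filter, Finset.mem_univ, true_and] at this
    exact Bool.eq_iff_iff.2 this
  set 𝒜 := F.image φ
  have hvc : 𝒜.vcDim ≤ d := by
    refine Finset.sup_le fun s hs => ?_
    rw [Finset.mem_shatterer] at hs
    have key : ∀ t ⊆ s, ∃ h ∈ H, ∀ i ∈ s, (h (x i) = true ↔ i ∈ t) := by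
      intro t ht
      obtain ⟨_, hw, hst⟩ := hs ht
      obtain ⟨u, hu, rfl⟩ := Finset.mem_image.1 hw
      obtain ⟨h, hh, hhu⟩ := hF u hu
      refine ⟨h, hh, fun i hi => ?_⟩
      rw [← hst, hhu]
      simp [φ, hi]
    -- The points may repeat, but shattered indices carry distinct points: the pattern singling out
    -- `i` separates `x i` from the others.
    have hinj : Set.InjOn x s := by
      intro i hi j hj hij
      obtain ⟨h, _, hh⟩ := key {i} (by simpa using hi)
      have h1 := (hh i hi).2 (by simp)
      rw [hij] at h1
      exact (Finset.mem_singleton.1 ((hh j hj).1 h1)).symm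
    rw [← Finset.card_image_of_injOn hinj]
    refine hd _ fun t _ => ?_
    obtain ⟨h, hh, hht⟩ := key (s.filter fun i => x i ∈ t) (Finset.filter_subset _ _)
    refine ⟨h, hh, fun y hy => ?_⟩
    obtain ⟨i, hi, rfl⟩ := Finset.mem_image.1 hy
    rw [hht i hi]
    simp [hi]
  calc F.card = 𝒜.card := (Finset.card_image_of_injective _ hφ).symm
    _ ≤ 𝒜.shatterer.card := Finset.card_le_card_shatterer _
    _ ≤ ∑ k ∈ Finset.Iic 𝒜.vcDim, (Fintype.card (Fin m)).choose k :=
        Finset.card_shatterer_le_sum_vcDim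
    _ ≤ ∑ k ∈ Finset.Iic d, (Fintype.card (Fin m)).choose k :=
        Finset.sum_le_sum_of_subset (Finset.Iic_subset_Iic.2 hvc)
    _ ≤ ∑ _k ∈ Finset.Iic d, m ^ d := by
        refine Finset.sum_le_sum fun k hk => ?_
        rw [Fintype.card_fin]
        exact (Nat.choose_le_pow m k).trans (Nat.pow_le_pow_right hm (Finset.mem_Iic.1 hk))
    _ = (d + 1) * m ^ d := by simp
    _ ≤ (2 * m) ^ d := by
        rw [mul_pow]
        exact Nat.mul_le_mul_right _ Nat.lt_two_pow_self

/-- Well separated patterns stay distinct on a suitable tuple of `m` coordinates. -/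
theorem exists_injOn_comp {κ : Type*} [Fintype κ] [Nonempty κ]
    (U : Finset (κ → Bool)) {ε : ℝ} {m : ℕ}
    (hsep : ∀ u ∈ U, ∀ w ∈ U, u ≠ w → ε * Fintype.card κ ≤ hammingDist u w)
    (hlt : (U.card : ℝ) ^ 2 * (1 - ε) ^ m < 1) :
    ∃ f : Fin m → κ, Set.InjOn (fun u : κ → Bool => u ∘ f) U := by
  classical
  set N := Fintype.card κ
  have hN : (0 : ℝ) < N := by exact_mod_cast Fintype.card_pos
  by_contra! hcon
  let agree : (κ → Bool) × (κ → Bool) → Finset κ :=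
    fun q => Finset.univ.filter fun i => q.1 i = q.2 i
  let bad : (κ → Bool) × (κ → Bool) → Finset (Fin m → κ) :=
    fun q => Fintype.piFinset fun _ => agree q
  -- Union bound by counting: if every tuple fails, each is contained in the agreement set of some
  -- pair of distinct patterns.
  have hcover : (Finset.univ : Finset (Fin m → κ)) ⊆ U.offDiag.biUnion bad := by
    intro f _
    have hf := hcon f
    rw [Set.InjOn] at hf
    push Not at hf
    obtain ⟨u, hu, w, hw, huw, hne⟩ := hf
    refine Finset.mem_biUnion.2 ⟨(u, w), Finset.mem_offDiag.2 ⟨hu, hw, hne⟩, ?_⟩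
    simp only [bad, agree, Fintype.mem_piFinset, Finset.mem_filter, Finset.mem_univ, true_and]
    exact fun i => congrFun huw i
  have hbad : ∀ q ∈ U.offDiag, ((bad q).card : ℝ) ≤ ((1 - ε) * N) ^ m := by
    intro q hq
    rw [Finset.mem_offDiag] at hq
    have h1 : (agree q).card + hammingDist q.1 q.2 = N := by
      simp only [agree, hammingDist, N]
      exact Finset.card_filter_add_card_filter_not _
    have h2 := hsep _ hq.1 _ hq.2.1 hq.2.2
    have h3 : ((agree q).card : ℝ) + hammingDist q.1 q.2 = N := by exact_mod_cast h1
    simp only [bad, Fintype.card_piFinset_const, Nat.cast_pow]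
    gcongr
    linarith
  have hcard := (Finset.card_le_card hcover).trans Finset.card_biUnion_le
  rw [Finset.card_univ, Fintype.card_fun, Fintype.card_fin] at hcard
  have hcard' : (N : ℝ) ^ m ≤ ∑ q ∈ U.offDiag, ((bad q).card : ℝ) := by exact_mod_cast hcard
  have h4 := hcard'.trans (Finset.sum_le_sum hbad)
  rw [Finset.sum_const, nsmul_eq_mul, mul_pow] at h4
  have h5 : (U.offDiag.card : ℝ) ≤ (U.card : ℝ) ^ 2 := by
    rw [Finset.offDiag_card, sq]
    exact_mod_cast Nat.sub_le _ _
  have hNm : (0 : ℝ) < (N : ℝ) ^ m := by positivity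
  -- Since `ε ≤ 1` is not assumed, positivity is extracted from the counting inequality itself.
  have hpos : 0 < (1 - ε) ^ m := by
    by_contra! h
    have : (U.offDiag.card : ℝ) * ((1 - ε) ^ m * (N : ℝ) ^ m) ≤ 0 :=
      mul_nonpos_of_nonneg_of_nonpos (by positivity) (mul_nonpos_of_nonpos_of_nonneg h hNm.le)
    linarith
  have h6 : (U.offDiag.card : ℝ) * ((1 - ε) ^ m * (N : ℝ) ^ m)
      ≤ ((U.card : ℝ) ^ 2 * (1 - ε) ^ m) * (N : ℝ) ^ m := by
    rw [mul_assoc]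
    gcongr
  nlinarith

/-- Exponential growth beats linear growth. The threshold makes the union bound over pairs of
patterns succeed in the packing argument below. -/
theorem exists_two_pow_gt (d : ℕ) : ∃ p : ℕ, ∀ q, p ≤ q → 2 * ((3 * q + 1) * d + 1) < 2 ^ q := by
  have h : Filter.Tendsto (fun q : ℕ => ((q : ℝ) ^ 1 / 2 ^ q)) Filter.atTop (nhds 0) :=
    tendsto_pow_const_div_const_pow_of_one_lt 1 (by norm_num)
  have h2 := h.eventually (gt_mem_nhds (show (0 : ℝ) < 1 / (8 * d + 2) by positivity))
  obtain ⟨p, hp⟩ := Filter.eventually_atTop.1 h2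
  refine ⟨p + 1, fun q hq => ?_⟩
  have h3 := hp q (by omega)
  rw [pow_one, div_lt_div_iff₀ (by positivity) (by positivity), one_mul] at h3
  have h4 : q * (8 * d + 2) < 2 ^ q := by exact_mod_cast h3
  nlinarith [Nat.zero_le d, Nat.mul_le_mul_right d (show 1 ≤ q by omega)]

/-- Packing bound for the patterns of a class of finite VC dimension. -/
theorem card_packing_le {X : Type*} {H : Set (X → Bool)} {d : ℕ}
    (hd : ∀ s : Finset X, Shatters H s → s.card ≤ d) {p : ℕ}
    (hp : ∀ q, p ≤ q → 2 * ((3 * q + 1) * d + 1) < 2 ^ q)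
    {κ : Type*} [Fintype κ] [Nonempty κ] (x : κ → X) (j : ℕ) (U : Finset (κ → Bool))
    (hU : ∀ u ∈ U, ∃ h ∈ H, ∀ i, h (x i) = u i)
    (hsep : ∀ u ∈ U, ∀ w ∈ U, u ≠ w → Fintype.card κ < 4 ^ j * hammingDist u w) :
    U.card ≤ 2 ^ ((3 * (j + p) + 1) * d) := by
  classical
  set q := j + p with hq
  set e := (3 * q + 1) * d with he
  by_contra! hcon
  -- Keep exactly `2 ^ e + 1` patterns. Some `2 ^ (3 * q)` coordinates still tell them apart, while
  -- Sauer's bound there is `(2 * 2 ^ (3 * q)) ^ d = 2 ^ e`, a contradiction.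
  obtain ⟨V, hVU, hV⟩ := Finset.exists_subset_card_eq (Nat.succ_le_of_lt hcon)
  have hVle : (V.card : ℝ) ^ 2 ≤ 2 ^ (2 * (e + 1)) := by
    have : V.card ≤ 2 ^ (e + 1) := by
      rw [hV, pow_succ]
      have := Nat.one_le_two_pow (n := e)
      omega
    rw [mul_comm 2, pow_mul]
    gcongr
    exact_mod_cast this
  have h0 : (0 : ℝ) ≤ 1 - (1 / 4 : ℝ) ^ j := by
    linarith [pow_le_one₀ (n := j) (show (0 : ℝ) ≤ 1 / 4 by norm_num) (by norm_num)]
  have hexp : (1 - (1 / 4 : ℝ) ^ j) ^ (2 ^ (3 * q)) ≤ (1 / 2) ^ (2 ^ q) := by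
    have h1 : (1 - (1 / 4 : ℝ) ^ j) ^ (4 ^ j) ≤ 1 / 2 := by
      have h2 : (1 - (1 / 4 : ℝ) ^ j) ≤ Real.exp (-(1 / 4 : ℝ) ^ j) := Real.one_sub_le_exp_neg _
      calc (1 - (1 / 4 : ℝ) ^ j) ^ (4 ^ j) ≤ Real.exp (-(1 / 4 : ℝ) ^ j) ^ (4 ^ j) := by gcongr
        _ = Real.exp (-1) := by
          rw [← Real.exp_nat_mul]
          congr 1
          push_cast
          rw [mul_neg, ← mul_pow]
          norm_num
        _ ≤ 1 / 2 := by
          rw [Real.exp_neg, one_div]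
          gcongr
          linarith [Real.add_one_le_exp 1]
    have h3 : 4 ^ j * 2 ^ q ≤ 2 ^ (3 * q) := by
      rw [show (4 : ℕ) = 2 ^ 2 by norm_num, ← pow_mul, ← pow_add]
      exact Nat.pow_le_pow_right (by norm_num) (by omega)
    calc _ ≤ (1 - (1 / 4 : ℝ) ^ j) ^ (4 ^ j * 2 ^ q) :=
          pow_le_pow_of_le_one h0 (by linarith [show (0 : ℝ) < (1 / 4 : ℝ) ^ j by positivity]) h3
      _ = ((1 - (1 / 4 : ℝ) ^ j) ^ (4 ^ j)) ^ (2 ^ q) := pow_mul _ _ _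
      _ ≤ (1 / 2) ^ (2 ^ q) := by gcongr
  have hlt : (V.card : ℝ) ^ 2 * (1 - (1 / 4 : ℝ) ^ j) ^ (2 ^ (3 * q)) < 1 := by
    have h1 : (2 : ℝ) ^ (2 * (e + 1)) < 2 ^ (2 ^ q) :=
      pow_lt_pow_right₀ (by norm_num) (hp q (by omega))
    calc _ ≤ (2 : ℝ) ^ (2 * (e + 1)) * (1 / 2) ^ (2 ^ q) :=
          mul_le_mul hVle hexp (pow_nonneg h0 _) (by positivity)
      _ < 2 ^ (2 ^ q) * (1 / 2) ^ (2 ^ q) := by gcongr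
      _ = 1 := by rw [← mul_pow]; norm_num
  obtain ⟨f, hf⟩ := exists_injOn_comp V (ε := (1 / 4 : ℝ) ^ j) (m := 2 ^ (3 * q)) (by
    intro u hu w hw huw
    have h1 : (Fintype.card κ : ℝ) ≤ 4 ^ j * hammingDist u w := by
      exact_mod_cast (hsep u (hVU hu) w (hVU hw) huw).le
    calc (1 / 4 : ℝ) ^ j * Fintype.card κ ≤ (1 / 4 : ℝ) ^ j * (4 ^ j * hammingDist u w) := by gcongr
      _ = hammingDist u w := by rw [← mul_assoc, ← mul_pow]; norm_num) hlt
  have h1 := card_realized_le hd (m := 2 ^ (3 * q)) Nat.one_le_two_pow (x ∘ f)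
    (V.image fun u => u ∘ f) (by
      intro w hw
      obtain ⟨u, hu, rfl⟩ := Finset.mem_image.1 hw
      obtain ⟨h, hh, hhu⟩ := hU u (hVU hu)
      exact ⟨h, hh, fun i => hhu (f i)⟩)
  rw [Finset.card_image_of_injOn hf, hV, ← pow_succ', ← pow_mul, ← he] at h1
  exact absurd h1 (Nat.not_succ_le_self _)

/-! ### Chaining -/

/-- A maximal separated subset is a net. -/
theorem exists_net {κ : Type*} [Fintype κ] {T : Set (κ → Bool)} {B : ℕ} (j : ℕ)
    (hB : ∀ U : Finset (κ → Bool), (∀ u ∈ U, u ∈ T) →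
      (∀ u ∈ U, ∀ w ∈ U, u ≠ w → Fintype.card κ < 4 ^ j * hammingDist u w) → U.card ≤ B) :
    ∃ (U : Finset (κ → Bool)) (π : (κ → Bool) → κ → Bool), U.card ≤ B ∧
      ∀ t ∈ T, π t ∈ U ∧ 4 ^ j * hammingDist t (π t) ≤ Fintype.card κ := by
  classical
  let 𝒰 : Finset (Finset (κ → Bool)) := Finset.univ.filter fun U =>
    (∀ u ∈ U, u ∈ T) ∧ ∀ u ∈ U, ∀ w ∈ U, u ≠ w → Fintype.card κ < 4 ^ j * hammingDist u w
  have hne : 𝒰.Nonempty := ⟨∅, by simp [𝒰]⟩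
  obtain ⟨U, hU, hmax⟩ := Finset.exists_max_image 𝒰 Finset.card hne
  obtain ⟨hUT, hUs⟩ := (Finset.mem_filter.1 hU).2
  have hnet : ∀ t ∈ T, ∃ u ∈ U, 4 ^ j * hammingDist t u ≤ Fintype.card κ := by
    intro t ht
    by_contra! hcon
    have htU : t ∉ U := fun h => by simpa using hcon t h
    have hins : insert t U ∈ 𝒰 := by
      refine Finset.mem_filter.2 ⟨Finset.mem_univ _, ?_, ?_⟩
      · intro u hu
        rcases Finset.mem_insert.1 hu with rfl | hu
        exacts [ht, hUT u hu]
      · intro u hu w hw huw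
        rcases Finset.mem_insert.1 hu with rfl | hu' <;> rcases Finset.mem_insert.1 hw with rfl | hw'
        · exact absurd rfl huw
        · exact hcon w hw'
        · rw [hammingDist_comm]
          exact hcon u hu'
        · exact hUs u hu' w hw' huw
    have := hmax _ hins
    rw [Finset.card_insert_of_notMem htU] at this
    omega
  choose! π hπ using hnet
  exact ⟨U, π, hB U hUT hUs, hπ⟩

/-- Adds up the chaining scales: the radius halves at each level while the logarithm of the number
of links grows linearly. -/
theorem sum_geometric_linear_le {a b : ℝ} (ha : 0 ≤ a) (hb : 0 ≤ b) (J : ℕ) :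
    ∑ j ∈ Finset.range J, (1 / 2 : ℝ) ^ j * (a * j + b) ≤ 2 * a + 2 * b := by
  have h : ∑ j ∈ Finset.range J, (1 / 2 : ℝ) ^ j * (a * j + b)
      = 2 * a + 2 * b - (1 / 2 : ℝ) ^ J * (2 * a * J + 2 * a + 2 * b) := by
    induction J with
    | zero => simp
    | succ J ih =>
      rw [Finset.sum_range_succ, ih]
      push_cast
      ring
  rw [h]
  have : 0 ≤ (1 / 2 : ℝ) ^ J * (2 * a * J + 2 * a + 2 * b) := by positivity
  linarith

theorem log_two_pow_add_one_le {N B : ℕ} (h : N ≤ 2 ^ B) : Real.log (N + 1) + 1 / 2 ≤ B + 2 := by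
  have h1 : ((N : ℝ) + 1) ≤ 2 ^ (B + 1) := by
    have : N + 1 ≤ 2 ^ (B + 1) := by
      rw [pow_succ]
      have := Nat.one_le_two_pow (n := B)
      omega
    exact_mod_cast this
  have h2 := Real.log_le_log (by positivity) h1
  rw [Real.log_pow] at h2
  have h3 : Real.log 2 ≤ 1 := by linarith [Real.log_two_lt_d9]
  push_cast at h2
  nlinarith [Nat.cast_nonneg (α := ℝ) B]

/-- Chaining: the expected supremum of a signed process over patterns with polynomial packing
numbers is of order `√(card κ)`. -/
theorem sum_selected_chaining_le {ι κ : Type*} [Fintype ι] [DecidableEq ι] [Fintype κ] [Nonempty κ]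
    {T : Set (κ → Bool)} {A : ℕ}
    (hA : ∀ (j : ℕ) (U : Finset (κ → Bool)), (∀ u ∈ U, u ∈ T) →
      (∀ u ∈ U, ∀ w ∈ U, u ≠ w → Fintype.card κ < 4 ^ j * hammingDist u w) →
      U.card ≤ 2 ^ (A * (j + 1)))
    (a : (κ → Bool) → ι → ℝ) (ha : ∀ s t, ∑ i, (a s i - a t i) ^ 2 ≤ 2 * hammingDist s t)
    (ha₀ : ∀ t, ∑ i, a t i ^ 2 ≤ 2 * Fintype.card κ)
    (t : (ι → Bool) → κ → Bool) (ht : ∀ σ, t σ ∈ T)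
    (c : (ι → Bool) → ℝ) (hc : ∀ σ, c σ = 0 ∨ c σ = 1) :
    ∑ σ, c σ * signedSum σ (a (t σ))
      ≤ 2 ^ Fintype.card ι * ((22 * A + 12) * √(Fintype.card κ)) := by
  classical
  set N := Fintype.card κ
  have hN : (0 : ℝ) < N := by exact_mod_cast Fintype.card_pos
  set n := Fintype.card ι
  choose U π hUcard hπ using fun j => exists_net (T := T) j (hA j)
  -- The chain ends exactly at level `N`: since `4 ^ N > N`, a nonzero integer distance would be too
  -- large there.
  have hlast : ∀ u ∈ T, π N u = u := by
    intro u hu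
    have h1 := (hπ N u hu).2
    have h2 : N < 4 ^ N := Nat.lt_pow_self (by norm_num)
    by_contra hne
    have h3 : 0 < hammingDist u (π N u) := hammingDist_pos.2 fun h => hne h.symm
    have := Nat.le_mul_of_pos_right (4 ^ N) h3
    omega
  have hdist : ∀ j, ∀ u ∈ T, (hammingDist u (π j u) : ℝ) ≤ (1 / 4) ^ j * N := by
    intro j u hu
    have h1 : (4 : ℝ) ^ j * hammingDist u (π j u) ≤ N := by exact_mod_cast (hπ j u hu).2
    calc (hammingDist u (π j u) : ℝ) = (1 / 4) ^ j * (4 ^ j * hammingDist u (π j u)) := by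
          rw [← mul_assoc, ← mul_pow]; norm_num
      _ ≤ (1 / 4) ^ j * N := by gcongr
  have hsq : √(N : ℝ) ^ 2 = N := Real.sq_sqrt hN.le
  have hzero : ∑ σ, c σ * signedSum σ (a (π 0 (t σ))) ≤ 2 ^ n * (2 * √N * (A + 2)) := by
    refine (sum_selected_signedSum_le (U 0) a (fun σ => π 0 (t σ)) c hc
      (fun σ => (hπ 0 _ (ht σ)).1) (r := 2 * √N) (by positivity) ?_).trans ?_
    · intro u _
      refine (ha₀ u).trans ?_
      rw [mul_pow, hsq]
      linarith
    · refine mul_le_mul_of_nonneg_left (mul_le_mul_of_nonneg_left ?_ (by positivity))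
        (by positivity)
      have := log_two_pow_add_one_le (hUcard 0)
      rwa [zero_add, mul_one] at this
  have hlink : ∀ j, ∑ σ, c σ * signedSum σ (fun i => a (π (j + 1) (t σ)) i - a (π j (t σ)) i)
      ≤ 2 ^ n * (2 * √N * ((1 / 2) ^ j * (2 * A * j + (3 * A + 2)))) := by
    intro j
    set r : ℝ := 2 * √N * (1 / 2) ^ j with hr
    -- The possible links: pairs of consecutive net points, restricted to those with increment at
    -- most `r`. The actual links qualify, since the triangle inequality gives squared increment at
    -- most `2 * (1/4 + 1) * (1/4) ^ j * N ≤ r ^ 2`.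
    let s : Finset ((κ → Bool) × (κ → Bool)) :=
      (U (j + 1) ×ˢ U j).filter fun q => ∑ i, (a q.1 i - a q.2 i) ^ 2 ≤ r ^ 2
    have hcard : s.card ≤ 2 ^ (2 * A * j + 3 * A) := by
      refine (Finset.card_filter_le _ _).trans ?_
      rw [Finset.card_product]
      refine (Nat.mul_le_mul (hUcard _) (hUcard _)).trans ?_
      rw [← pow_add]
      exact Nat.pow_le_pow_right (by norm_num) (by ring_nf; omega)
    refine (sum_selected_signedSum_le s (fun q i => a q.1 i - a q.2 i)
      (fun σ => (π (j + 1) (t σ), π j (t σ))) c hc ?_ (r := r) (by positivity) ?_).trans ?_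
    · intro σ
      refine Finset.mem_filter.2 ⟨Finset.mem_product.2
        ⟨(hπ _ _ (ht σ)).1, (hπ _ _ (ht σ)).1⟩, (ha _ _).trans ?_⟩
      have h1 : (hammingDist (π (j + 1) (t σ)) (π j (t σ)) : ℝ)
          ≤ hammingDist (t σ) (π (j + 1) (t σ)) + hammingDist (t σ) (π j (t σ)) := by
        exact_mod_cast hammingDist_triangle_left _ _ _
      have h2 := hdist (j + 1) _ (ht σ)
      have h3 := hdist j _ (ht σ)
      have h4 : r ^ 2 = 4 * ((1 / 4) ^ j * N) := by
        rw [hr, mul_pow, mul_pow, hsq, ← pow_mul, mul_comm j 2, pow_mul]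
        norm_num
        ring
      rw [pow_succ] at h2
      have h5 : 0 ≤ (1 / 4 : ℝ) ^ j * N := by positivity
      dsimp only
      rw [h4]
      linarith
    · intro q hq
      exact (Finset.mem_filter.1 hq).2
    · have h1 := log_two_pow_add_one_le hcard
      push_cast at h1
      calc 2 ^ n * (r * (Real.log (s.card + 1) + 1 / 2))
          ≤ 2 ^ n * (r * (2 * A * j + 3 * A + 2)) := by gcongr
        _ = _ := by rw [hr]; ring
  have htel : ∀ σ, c σ * signedSum σ (a (t σ)) = c σ * signedSum σ (a (π 0 (t σ))) +
      ∑ j ∈ Finset.range N,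
        c σ * signedSum σ (fun i => a (π (j + 1) (t σ)) i - a (π j (t σ)) i) := by
    intro σ
    simp_rw [signedSum_sub, ← Finset.mul_sum]
    rw [Finset.sum_range_sub (fun j => signedSum σ (a (π j (t σ)))), hlast _ (ht σ)]
    ring
  simp_rw [htel, Finset.sum_add_distrib]
  rw [Finset.sum_comm]
  calc _ ≤ 2 ^ n * (2 * √N * (A + 2)) + ∑ j ∈ Finset.range N,
        2 ^ n * (2 * √N * ((1 / 2) ^ j * (2 * A * j + (3 * A + 2)))) :=
        add_le_add hzero (Finset.sum_le_sum fun j _ => hlink j)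
    _ = 2 ^ n * (2 * √N * (A + 2)) + 2 ^ n * (2 * √N *
        ∑ j ∈ Finset.range N, (1 / 2 : ℝ) ^ j * (2 * A * j + (3 * A + 2))) := by
        simp_rw [← Finset.mul_sum]
    _ ≤ 2 ^ n * (2 * √N * (A + 2)) + 2 ^ n * (2 * √N * (2 * (2 * A) + 2 * (3 * A + 2))) := by
        gcongr
        exact sum_geometric_linear_le (by positivity) (by positivity) N
    _ = _ := by ring

/-! ### Symmetrization with a ghost sample -/

/-- Reindexing an i.i.d. family preserves its law. -/
theorem measurePreserving_comp_equiv {κ κ' α : Type*} [Fintype κ] [Fintype κ'] [MeasurableSpace α]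
    (e : κ' ≃ κ) (P : Measure α) [SigmaFinite P] :
    MeasurePreserving (fun ω : κ → α => ω ∘ e) (Measure.pi fun _ => P)
      (Measure.pi fun _ => P) := by
  have hm : Measurable fun ω : κ → α => ω ∘ e :=
    measurable_pi_lambda _ fun i => measurable_pi_apply (e i)
  refine ⟨hm, (Measure.pi_eq fun s hs => ?_).symm⟩
  · rw [Measure.map_apply hm (MeasurableSet.univ_pi hs)]
    have : (fun ω : κ → α => ω ∘ e) ⁻¹' Set.univ.pi s = Set.univ.pi fun k => s (e.symm k) := by
      ext ω
      simp only [Set.mem_preimage, Set.mem_univ_pi, Function.comp_apply]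
      exact ⟨fun h k => by simpa using h (e.symm k), fun h i => by simpa using h (e i)⟩
    rw [this, Measure.pi_pi]
    exact e.symm.prod_comp fun i => P (s i)

/-- Upper expectations need majorants valid everywhere, so a measurable version is raised to `⊤` on
a measurable null set containing all points of disagreement. -/
theorem exists_measurable_ge_ae_eq {Ω : Type*} [MeasurableSpace Ω] {μ : Measure Ω} {f : Ω → ℝ≥0∞}
    (hf : AEMeasurable f μ) : ∃ g : Ω → ℝ≥0∞, Measurable g ∧ f ≤ g ∧ g =ᵐ[μ] f := by
  classical
  set N := toMeasurable μ {ω | f ω ≠ hf.mk f ω} with hN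
  have hNmeas : MeasurableSet N := measurableSet_toMeasurable _ _
  have hN0 : μ N = 0 := by
    rw [hN, measure_toMeasurable]
    exact ae_iff.1 hf.ae_eq_mk
  refine ⟨N.piecewise (fun _ => ⊤) (hf.mk f),
    Measurable.piecewise hNmeas measurable_const hf.measurable_mk, fun ω => ?_, ?_⟩
  · by_cases h : ω ∈ N
    · simp [h]
    · rw [Set.piecewise_eq_of_notMem _ _ _ h]
      have : ω ∉ {ω | f ω ≠ hf.mk f ω} := fun h' => h (subset_toMeasurable _ _ h')
      exact (not_not.1 this).le
  · filter_upwards [measure_eq_zero_iff_ae_notMem.1 hN0, hf.ae_eq_mk] with ω h1 h2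
    rw [Set.piecewise_eq_of_notMem _ _ _ h1, h2]

/-- The real-valued zero-one loss. -/
noncomputable def zeroOneLoss (b y : Bool) : ℝ := if b ≠ y then 1 else 0

/-- The difference of the losses of the pattern `t` on the `i`-th ghost point and the `i`-th sample
point. -/
noncomputable def lossDiff {n : ℕ} (y t : Fin n ⊕ Fin n → Bool) (i : Fin n) : ℝ :=
  zeroOneLoss (t (.inr i)) (y (.inr i)) - zeroOneLoss (t (.inl i)) (y (.inl i))

/-- Exchange the `i`-th sample point with the `i`-th ghost point whenever `σ i` is false. -/
def swapPerm {n : ℕ} (σ : Fin n → Bool) : Equiv.Perm (Fin n ⊕ Fin n) :=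
  Function.Involutive.toPerm
    (Sum.elim (fun i => if σ i then .inl i else .inr i) fun i => if σ i then .inr i else .inl i) (by
      rintro (i | i) <;> cases h : σ i <;> simp [h])

theorem swapPerm_inl {n : ℕ} (σ : Fin n → Bool) (i : Fin n) :
    swapPerm σ (.inl i) = if σ i then .inl i else .inr i := rfl

theorem swapPerm_inr {n : ℕ} (σ : Fin n → Bool) (i : Fin n) :
    swapPerm σ (.inr i) = if σ i then .inr i else .inl i := rfl

theorem swapPerm_swapPerm {n : ℕ} (σ : Fin n → Bool) (k : Fin n ⊕ Fin n) :
    swapPerm σ (swapPerm σ k) = k := by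
  rcases k with i | i <;> cases h : σ i <;> simp [swapPerm_inl, swapPerm_inr, h]

/-- This is where the random signs come from: an exchange at `i` negates the `i`-th difference. -/
theorem lossDiff_comp_swapPerm {n : ℕ} (y t : Fin n ⊕ Fin n → Bool) (σ : Fin n → Bool)
    (i : Fin n) :
    lossDiff (y ∘ swapPerm σ) (t ∘ swapPerm σ) i = boolSign (σ i) * lossDiff y t i := by
  cases h : σ i <;> simp [swapPerm_inl, swapPerm_inr, lossDiff, boolSign, h]

/-- The `i`-th increment is at most the number (`0`, `1` or `2`) of disagreements at the `i`-th
pair, and `k² ≤ 2k` for such `k`. -/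
theorem sum_sq_lossDiff_sub_le {n : ℕ} (y s t : Fin n ⊕ Fin n → Bool) :
    ∑ i, (lossDiff y s i - lossDiff y t i) ^ 2 ≤ 2 * hammingDist s t := by
  have h : (hammingDist s t : ℝ) = ∑ i : Fin n, ((if s (.inl i) ≠ t (.inl i) then (1 : ℝ) else 0) +
      if s (.inr i) ≠ t (.inr i) then (1 : ℝ) else 0) := by
    rw [hammingDist, Finset.card_filter, Finset.sum_add_distrib]
    push_cast
    rw [Fintype.sum_sum_type]
  rw [h, Finset.mul_sum]
  refine Finset.sum_le_sum fun i _ => ?_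
  unfold lossDiff zeroOneLoss
  generalize s (.inl i) = a, s (.inr i) = b, t (.inl i) = c, t (.inr i) = d,
    y (.inl i) = u, y (.inr i) = v
  cases a <;> cases b <;> cases c <;> cases d <;> cases u <;> cases v <;> norm_num

theorem sum_sq_lossDiff_le {n : ℕ} (y t : Fin n ⊕ Fin n → Bool) :
    ∑ i, lossDiff y t i ^ 2 ≤ 2 * Fintype.card (Fin n ⊕ Fin n) := by
  have : ∀ i ∈ Finset.univ, lossDiff y t i ^ 2 ≤ 1 := by
    intro i _
    unfold lossDiff zeroOneLoss
    split_ifs <;> norm_num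
  refine (Finset.sum_le_sum this).trans ?_
  simp
  linarith [Nat.cast_nonneg (α := ℝ) n]

/-- The largest (positive) amount by which the number of errors on the ghost sample exceeds the
number of errors on the sample, over the patterns realized by `H`. -/
noncomputable def ghostDeviation {X : Type*} (H : Set (X → Bool)) {n : ℕ}
    (ω : Fin n ⊕ Fin n → X × Bool) : ℝ≥0∞ :=
  ⨆ b : Fin n ⊕ Fin n → Bool,
    {ω : Fin n ⊕ Fin n → X × Bool | ∃ h ∈ H, ∀ k, h (ω k).1 = b k}.indicator
      (fun ω => ENNReal.ofReal (∑ i, lossDiff (fun k => (ω k).2) b i)) ω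

theorem ofReal_sum_lossDiff_le_ghostDeviation {X : Type*} {H : Set (X → Bool)} {n : ℕ}
    (ω : Fin n ⊕ Fin n → X × Bool) {h : X → Bool} (hh : h ∈ H) :
    ENNReal.ofReal (∑ i, lossDiff (fun k => (ω k).2) (fun k => h (ω k).1) i)
      ≤ ghostDeviation H ω := by
  refine le_iSup_of_le (fun k => h (ω k).1) ?_
  rw [Set.indicator_of_mem]
  exact ⟨h, hh, fun _ => rfl⟩

/-- The supremum runs over finitely many patterns instead of over `H`, so only realizability of a
pattern on `n + n` points has to be null measurable, which is the assumption on the class. -/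
theorem aemeasurable_ghostDeviation {X : Type*} [MeasurableSpace X] {H : Set (X → Bool)}
    {P : ProbabilityMeasure (X × Bool)} (hP : IsMeasurableClass H (marginal P)) (n : ℕ) :
    AEMeasurable (ghostDeviation H (n := n)) (Measure.pi fun _ => (P : Measure (X × Bool))) := by
  unfold ghostDeviation
  refine AEMeasurable.iSup fun b => AEMeasurable.indicator₀ ?_ ?_
  · refine Measurable.aemeasurable ?_
    have h1 : Measurable fun y : Fin n ⊕ Fin n → Bool => ENNReal.ofReal (∑ i, lossDiff y b i) :=
      .of_discrete
    exact h1.comp (measurable_pi_lambda _ fun k => measurable_snd.comp (measurable_pi_apply k))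
  · have hfst : MeasurePreserving Prod.fst (P : Measure (X × Bool)) (marginal P) :=
      ⟨measurable_fst, rfl⟩
    have : IsProbabilityMeasure (marginal P) := by
      unfold marginal
      infer_instance
    have h1 := (measurePreserving_pi (ι := Fin (n + n)) (fun _ => (P : Measure (X × Bool)))
      (fun _ => marginal P) fun _ => hfst).comp
      (measurePreserving_comp_equiv (finSumFinEquiv (m := n) (n := n)).symm
        (P : Measure (X × Bool)))
    have h2 := (hP (n + n) (b ∘ finSumFinEquiv.symm)).preimage h1.quasiMeasurePreserving
    convert h2 using 1
    ext ω
    simp only [Set.mem_ofPred_eq, Set.mem_preimage, Function.comp_apply]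
    refine exists_congr fun h => and_congr_right fun _ => ?_
    exact ⟨fun h k => h _, fun h k => by simpa using h (finSumFinEquiv k)⟩

/-- The patterns of a class of finite VC dimension have polynomial packing numbers. -/
theorem exists_packing_exponent {X : Type*} {H : Set (X → Bool)} (hVC : FiniteVCDim H) :
    ∃ A : ℕ, ∀ (n : ℕ) (x : Fin n ⊕ Fin n → X), 1 ≤ n → ∀ (j : ℕ)
      (U : Finset (Fin n ⊕ Fin n → Bool)), (∀ u ∈ U, u ∈ {t | ∃ h ∈ H, ∀ k, h (x k) = t k}) →
      (∀ u ∈ U, ∀ w ∈ U, u ≠ w → Fintype.card (Fin n ⊕ Fin n) < 4 ^ j * hammingDist u w) →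
      U.card ≤ 2 ^ (A * (j + 1)) := by
  obtain ⟨d, hd⟩ := hVC
  obtain ⟨p, hp⟩ := exists_two_pow_gt d
  refine ⟨(3 * p + 3) * d, fun n x hn j U hU hsep => ?_⟩
  have : Nonempty (Fin n ⊕ Fin n) := ⟨.inl ⟨0, hn⟩⟩
  refine (card_packing_le hd hp x j U hU hsep).trans (Nat.pow_le_pow_right (by norm_num) ?_)
  have : 3 * (j + p) + 1 ≤ (3 * p + 3) * (j + 1) := by nlinarith [Nat.zero_le (p * j)]
  calc (3 * (j + p) + 1) * d ≤ (3 * p + 3) * (j + 1) * d := Nat.mul_le_mul_right _ this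
    _ = _ := by ring

/-- A pattern realized on the swapped points is, after undoing the swap, realized on the original
points, so the index set is the same for all `σ`, as chaining requires. The coefficient `c = 0`
covers an unrealized maximizer or a negative sum. -/
theorem exists_selector_ghostDeviation {X : Type*} {H : Set (X → Bool)} (hH : H.Nonempty) {n : ℕ}
    (ω : Fin n ⊕ Fin n → X × Bool) (σ : Fin n → Bool) :
    ∃ (t : Fin n ⊕ Fin n → Bool) (c : ℝ), (∃ h ∈ H, ∀ k, h (ω k).1 = t k) ∧ (c = 0 ∨ c = 1) ∧
      0 ≤ c * signedSum σ (lossDiff (fun k => (ω k).2) t) ∧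
      ghostDeviation H (ω ∘ swapPerm σ)
        ≤ ENNReal.ofReal (c * signedSum σ (lossDiff (fun k => (ω k).2) t)) := by
  obtain ⟨b, hb⟩ := exists_eq_ciSup_of_finite (f := fun b : Fin n ⊕ Fin n → Bool =>
    {ω : Fin n ⊕ Fin n → X × Bool | ∃ h ∈ H, ∀ k, h (ω k).1 = b k}.indicator
    (fun ω => ENNReal.ofReal (∑ i, lossDiff (fun k => (ω k).2) b i)) (ω ∘ swapPerm σ))
  rw [ghostDeviation, ← hb]
  have hzero : ∃ (t : Fin n ⊕ Fin n → Bool) (c : ℝ), (∃ h ∈ H, ∀ k, h (ω k).1 = t k) ∧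
      (c = 0 ∨ c = 1) ∧ 0 ≤ c * signedSum σ (lossDiff (fun k => (ω k).2) t) ∧
      (0 : ℝ≥0∞) ≤ ENNReal.ofReal (c * signedSum σ (lossDiff (fun k => (ω k).2) t)) := by
    obtain ⟨h, hh⟩ := hH
    exact ⟨fun k => h (ω k).1, 0, ⟨h, hh, fun _ => rfl⟩, Or.inl rfl, by simp, zero_le⟩
  by_cases hreal : ω ∘ swapPerm σ ∈
      {ω : Fin n ⊕ Fin n → X × Bool | ∃ h ∈ H, ∀ k, h (ω k).1 = b k}
  · rw [Set.indicator_of_mem hreal]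
    have hsum : ∑ i, lossDiff (fun k => ((ω ∘ swapPerm σ) k).2) b i
        = signedSum σ (lossDiff (fun k => (ω k).2) (b ∘ swapPerm σ)) := by
      unfold signedSum
      refine Finset.sum_congr rfl fun i _ => ?_
      rw [← lossDiff_comp_swapPerm]
      congr 1
      funext k
      simp [swapPerm_swapPerm]
    rw [hsum]
    rcases le_total 0 (signedSum σ (lossDiff (fun k => (ω k).2) (b ∘ swapPerm σ))) with hs | hs
    · obtain ⟨h, hh, hhb⟩ := hreal
      refine ⟨b ∘ swapPerm σ, 1, ⟨h, hh, fun k => ?_⟩, Or.inr rfl, by simpa using hs, by simp⟩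
      have := hhb (swapPerm σ k)
      simpa [swapPerm_swapPerm] using this
    · rw [ENNReal.ofReal_of_nonpos hs]
      exact hzero
  · rw [Set.indicator_of_notMem hreal]
    exact hzero

theorem sum_ghostDeviation_swapPerm_le {X : Type*} {H : Set (X → Bool)} (hH : H.Nonempty) {n : ℕ}
    (hn : 1 ≤ n) {A : ℕ} (ω : Fin n ⊕ Fin n → X × Bool)
    (hA : ∀ (j : ℕ) (U : Finset (Fin n ⊕ Fin n → Bool)),
      (∀ u ∈ U, u ∈ {t | ∃ h ∈ H, ∀ k, h (ω k).1 = t k}) →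
      (∀ u ∈ U, ∀ w ∈ U, u ≠ w → Fintype.card (Fin n ⊕ Fin n) < 4 ^ j * hammingDist u w) →
      U.card ≤ 2 ^ (A * (j + 1))) :
    ∑ σ : Fin n → Bool, ghostDeviation H (ω ∘ swapPerm σ)
      ≤ 2 ^ n * ENNReal.ofReal ((22 * A + 12) * √(n + n)) := by
  have : Nonempty (Fin n ⊕ Fin n) := ⟨.inl ⟨0, hn⟩⟩
  choose t c ht hc hnn hle using exists_selector_ghostDeviation hH ω
  have h1 := sum_selected_chaining_le hA (lossDiff fun k => (ω k).2)
    (sum_sq_lossDiff_sub_le _) (sum_sq_lossDiff_le _) t ht c hc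
  calc _ ≤ ∑ σ : Fin n → Bool,
        ENNReal.ofReal (c σ * signedSum σ (lossDiff (fun k => (ω k).2) (t σ))) :=
        Finset.sum_le_sum fun σ _ => hle σ
    _ = ENNReal.ofReal (∑ σ, c σ * signedSum σ (lossDiff (fun k => (ω k).2) (t σ))) :=
        (ENNReal.ofReal_sum_of_nonneg fun σ _ => hnn σ).symm
    _ ≤ ENNReal.ofReal (2 ^ n * ((22 * A + 12) * √(n + n))) := by
        refine ENNReal.ofReal_le_ofReal ?_
        simpa using h1
    _ = _ := by
        rw [ENNReal.ofReal_mul (by positivity), ENNReal.ofReal_pow (by norm_num)]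
        simp

/-- Symmetrization: a measurable majorant of the ghost deviation with expectation `O(√n)`. -/
theorem exists_measurable_ge_ghostDeviation {X : Type*} [MeasurableSpace X] {H : Set (X → Bool)}
    (hH : H.Nonempty) {P : ProbabilityMeasure (X × Bool)} (hP : IsMeasurableClass H (marginal P))
    {n : ℕ} (hn : 1 ≤ n) {A : ℕ}
    (hA : ∀ (x : Fin n ⊕ Fin n → X) (j : ℕ) (U : Finset (Fin n ⊕ Fin n → Bool)),
      (∀ u ∈ U, u ∈ {t | ∃ h ∈ H, ∀ k, h (x k) = t k}) →
      (∀ u ∈ U, ∀ w ∈ U, u ≠ w → Fintype.card (Fin n ⊕ Fin n) < 4 ^ j * hammingDist u w) →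
      U.card ≤ 2 ^ (A * (j + 1))) :
    ∃ g : (Fin n ⊕ Fin n → X × Bool) → ℝ≥0∞, Measurable g ∧ ghostDeviation H ≤ g ∧
      ∫⁻ ω, g ω ∂(Measure.pi fun _ => (P : Measure (X × Bool)))
        ≤ ENNReal.ofReal ((22 * A + 12) * √(n + n)) := by
  obtain ⟨g, hg, hle, hae⟩ := exists_measurable_ge_ae_eq (aemeasurable_ghostDeviation hP n)
  refine ⟨g, hg, hle, ?_⟩
  set μ : Measure (Fin n ⊕ Fin n → X × Bool) := Measure.pi fun _ => (P : Measure (X × Bool))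
  have hmp : ∀ σ : Fin n → Bool, MeasurePreserving
      (fun ω : Fin n ⊕ Fin n → X × Bool => ω ∘ swapPerm σ) μ μ :=
    fun σ => measurePreserving_comp_equiv (swapPerm σ) _
  -- Invariance of the law under each of the `2 ^ n` swaps turns the integral into an average over
  -- signs, bounded pointwise by chaining.
  have h1 : (2 : ℝ≥0∞) ^ n * ∫⁻ ω, g ω ∂μ = ∫⁻ ω, ∑ σ : Fin n → Bool, g (ω ∘ swapPerm σ) ∂μ := by
    rw [lintegral_finsetSum _ (f := fun σ ω => g (ω ∘ swapPerm σ))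
      fun σ _ => hg.comp (hmp σ).measurable]
    simp_rw [fun σ => (hmp σ).lintegral_comp hg]
    simp
  have h2 : ∀ᵐ ω ∂μ, ∑ σ : Fin n → Bool, g (ω ∘ swapPerm σ)
      ≤ 2 ^ n * ENNReal.ofReal ((22 * A + 12) * √(n + n)) := by
    have h3 : ∀ᵐ ω ∂μ, ∀ σ : Fin n → Bool,
        g (ω ∘ swapPerm σ) = ghostDeviation H (ω ∘ swapPerm σ) :=
      ae_all_iff.2 fun σ => (hmp σ).quasiMeasurePreserving.ae hae
    filter_upwards [h3] with ω hω
    simp_rw [hω]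
    exact sum_ghostDeviation_swapPerm_le hH hn ω (hA fun k => (ω k).1)
  have h4 := lintegral_mono_ae h2
  rw [← h1, lintegral_const, measure_univ, mul_one] at h4
  exact (ENNReal.mul_le_mul_iff_right (by simp) (by simp)).1 h4

/-! ### Empirical risk minimization -/

/-- The number of errors of `h` on the sample `S`. -/
def errorCount {X : Type*} {n : ℕ} (h : X → Bool) (S : Fin n → X × Bool) : ℕ :=
  (Finset.univ.filter fun i => h (S i).1 ≠ (S i).2).card

theorem measurableSet_error {X : Type*} [MeasurableSpace X] {h : X → Bool} (hh : Measurable h) :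
    MeasurableSet {p : X × Bool | h p.1 ≠ p.2} :=
  (measurableSet_eq_fun (hh.comp measurable_fst) measurable_snd).compl

theorem errorCount_eq_sum {X : Type*} {n : ℕ} (h : X → Bool) (S : Fin n → X × Bool) :
    (errorCount h S : ℝ≥0∞) = ∑ i, {p : X × Bool | h p.1 ≠ p.2}.indicator 1 (S i) := by
  simp [errorCount, Finset.card_filter, Set.indicator_apply]

theorem measurable_errorCount {X : Type*} [MeasurableSpace X] {n : ℕ} {h : X → Bool}
    (hh : Measurable h) : Measurable fun S : Fin n → X × Bool => (errorCount h S : ℝ≥0∞) := by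
  simp_rw [errorCount_eq_sum]
  exact Finset.measurable_sum _ fun i _ =>
    (measurable_one.indicator (measurableSet_error hh)).comp (measurable_pi_apply i)

theorem lintegral_errorCount {X : Type*} [MeasurableSpace X] {n : ℕ} {h : X → Bool}
    (hh : Measurable h) (P : ProbabilityMeasure (X × Bool)) :
    ∫⁻ S, (errorCount h S : ℝ≥0∞) ∂(sampleLaw P n) = n * risk P h := by
  simp_rw [errorCount_eq_sum]
  have hm : Measurable ({p : X × Bool | h p.1 ≠ p.2}.indicator (1 : X × Bool → ℝ≥0∞)) :=
    measurable_one.indicator (measurableSet_error hh)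
  rw [lintegral_finsetSum _ (f := fun i (S : Fin n → X × Bool) => Set.indicator _ _ (S i))
    fun i _ => hm.comp (measurable_pi_apply i)]
  have : ∀ i : Fin n, ∫⁻ S, {p : X × Bool | h p.1 ≠ p.2}.indicator (1 : X × Bool → ℝ≥0∞) (S i)
      ∂(sampleLaw P n) = risk P h := by
    intro i
    have := (measurePreserving_eval (fun _ : Fin n => (P : Measure (X × Bool))) i).lintegral_comp hm
    rw [lintegral_indicator_one (measurableSet_error hh)] at this
    exact this
  simp [this]

theorem errorCount_ghost_le {X : Type*} {H : Set (X → Bool)} {n : ℕ} {h : X → Bool} (hh : h ∈ H)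
    (S S' : Fin n → X × Bool) :
    (errorCount h S' : ℝ≥0∞) ≤ errorCount h S + ghostDeviation H (Sum.elim S S') := by
  refine le_trans ?_ (add_le_add_right (ofReal_sum_lossDiff_le_ghostDeviation (Sum.elim S S') hh) _)
  have h1 : ∀ S : Fin n → X × Bool,
      (errorCount h S : ℝ) = ∑ i, zeroOneLoss (h (S i).1) (S i).2 := by
    intro S
    simp [errorCount, Finset.card_filter, zeroOneLoss]
  have h2 : ∑ i, lossDiff (fun k => (Sum.elim S S' k).2) (fun k => h (Sum.elim S S' k).1) i
      = (errorCount h S' : ℝ) - errorCount h S := by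
    simp only [lossDiff, Finset.sum_sub_distrib, h1, Sum.elim_inl, Sum.elim_inr]
  rw [h2, ← ENNReal.ofReal_natCast, ← ENNReal.ofReal_natCast]
  refine le_trans (ENNReal.ofReal_le_ofReal ?_) ENNReal.ofReal_add_le
  linarith

theorem exists_errorCount_minimizer {X : Type*} {H : Set (X → Bool)} (hH : H.Nonempty) {n : ℕ}
    (S : Fin n → X × Bool) : ∃ h ∈ H, ∀ h' ∈ H, errorCount h S ≤ errorCount h' S := by
  obtain ⟨h, hh, hmin⟩ := (measure fun h : X → Bool => errorCount h S).wf.has_min H hH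
  exact ⟨h, hh, fun w hw => not_lt.1 (hmin w hw)⟩

/-- Empirical risk minimization has expected excess risk at most the expected ghost deviation. -/
theorem expectation_excessRisk_minimizer_le {X : Type*} [MeasurableSpace X] {H : Set (X → Bool)}
    (hmeas : ∀ h ∈ H, Measurable h) (hH : H.Nonempty) (P : ProbabilityMeasure (X × Bool))
    {n : ℕ} (hn : 1 ≤ n) {g : (Fin n ⊕ Fin n → X × Bool) → ℝ≥0∞} (hg : Measurable g)
    (hle : ghostDeviation H ≤ g)
    (f : (Fin n → X × Bool) → X → Bool)
    (hf : ∀ S, f S ∈ H ∧ ∀ h ∈ H, errorCount (f S) S ≤ errorCount h S) :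
    expectation (sampleLaw P n) (fun S => excessRisk P H (f S))
      ≤ (∫⁻ ω, g ω ∂(Measure.pi fun _ => (P : Measure (X × Bool)))) / n := by
  have hprob : IsProbabilityMeasure (sampleLaw P n) := by
    unfold sampleLaw
    infer_instance
  have hn0 : (n : ℝ≥0∞) ≠ 0 := by
    simp only [ne_eq, Nat.cast_eq_zero]
    omega
  have hmp := measurePreserving_sumPiEquivProdPi_symm (ι := Fin n) (ι' := Fin n)
    (fun _ => (P : Measure (X × Bool)))
  have hg' : Measurable fun q : (Fin n → X × Bool) × (Fin n → X × Bool) => g (Sum.elim q.1 q.2) :=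
    hg.comp hmp.measurable
  set G : (Fin n → X × Bool) → ℝ≥0∞ := fun S => ∫⁻ S', g (Sum.elim S S') ∂(sampleLaw P n) with hG
  have hGmeas : Measurable G := hg'.lintegral_prod_right'
  have hGint : ∫⁻ S, G S ∂(sampleLaw P n)
      = ∫⁻ ω, g ω ∂(Measure.pi fun _ => (P : Measure (X × Bool))) := by
    rw [← hmp.lintegral_comp hg]
    exact (lintegral_prod _ hg'.aemeasurable).symm
  -- Averaging over the ghost sample alone turns ghost errors into `n * risk P h`. The bound is
  -- uniform in `h`, so it applies to the data-dependent minimizer.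
  have hrisk : ∀ h ∈ H, ∀ S, risk P h ≤ (errorCount h S + G S) / n := by
    intro h hh S
    rw [ENNReal.le_div_iff_mul_le (Or.inl hn0) (Or.inl (ENNReal.natCast_ne_top n)), mul_comm,
      ← lintegral_errorCount (hmeas h hh) P]
    calc _ ≤ ∫⁻ S', ((errorCount h S : ℝ≥0∞) + g (Sum.elim S S')) ∂(sampleLaw P n) :=
          lintegral_mono fun S' => (errorCount_ghost_le hh S S').trans
            (add_le_add_right (hle _) _)
      _ = _ := by
        rw [lintegral_add_left measurable_const, lintegral_const, measure_univ, mul_one]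
  have hbest : ∀ h ∈ H, bestRisk P H ≤ risk P h := fun h hh => iInf₂_le h hh
  have hrisk1 : ∀ h, risk P h ≤ 1 := fun h => prob_le_one
  have hbtop : bestRisk P H ≠ ⊤ := by
    obtain ⟨h, hh⟩ := hH
    exact ((hbest h hh).trans_lt ((hrisk1 h).trans_lt ENNReal.one_lt_top)).ne
  set I := (∫⁻ ω, g ω ∂(Measure.pi fun _ => (P : Measure (X × Bool)))) / n with hI
  -- The best risk need not be attained: compare with each fixed `h`, then take the infimum.
  have hcomp : ∀ h ∈ H, expectation (sampleLaw P n) (fun S => excessRisk P H (f S))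
      + bestRisk P H ≤ I + risk P h := by
    intro h hh
    have hM : Measurable fun S : Fin n → X × Bool => ((errorCount h S : ℝ≥0∞) + G S) / n :=
      ((measurable_errorCount (hmeas h hh)).add hGmeas).div_const _
    have h1 : ∀ S, risk P (f S) ≤ (errorCount h S + G S) / n := fun S =>
      (hrisk _ (hf S).1 S).trans (by gcongr; exact (hf S).2 h hh)
    have h2 : expectation (sampleLaw P n) (fun S => excessRisk P H (f S))
        ≤ ∫⁻ S, ((errorCount h S + G S) / n - bestRisk P H) ∂(sampleLaw P n) :=
      iInf_le_of_le _ (iInf_le_of_le (hM.sub measurable_const)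
        (iInf_le_of_le (fun S => tsub_le_tsub_right (h1 S) _) le_rfl))
    have h3 : ∫⁻ S, ((errorCount h S : ℝ≥0∞) + G S) / n ∂(sampleLaw P n) = I + risk P h := by
      simp_rw [div_eq_mul_inv]
      rw [lintegral_mul_const _ (f := fun S => (errorCount h S : ℝ≥0∞) + G S)
          ((measurable_errorCount (hmeas h hh)).add hGmeas),
        lintegral_add_left (measurable_errorCount (hmeas h hh)), lintegral_errorCount (hmeas h hh),
        hGint, add_mul, mul_comm (n : ℝ≥0∞), mul_assoc,
        ENNReal.mul_inv_cancel hn0 (ENNReal.natCast_ne_top n), mul_one, add_comm, hI,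
        div_eq_mul_inv]
    rw [lintegral_sub measurable_const (by simpa using hbtop)
      (ae_of_all _ fun S => (hbest _ (hf S).1).trans (h1 S)), h3, lintegral_const, measure_univ,
      mul_one] at h2
    calc _ ≤ (I + risk P h - bestRisk P H) + bestRisk P H := by gcongr
      _ = _ := tsub_add_cancel_of_le ((hbest h hh).trans le_add_self)
  have hfin : expectation (sampleLaw P n) (fun S => excessRisk P H (f S)) + bestRisk P H
      ≤ I + bestRisk P H := by
    refine (le_iInf₂ hcomp).trans_eq ?_
    rw [bestRisk, ENNReal.add_iInf₂]
  exact (ENNReal.add_le_add_iff_right hbtop).1 hfin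

theorem exists_minimaxSL_le {X : Type*} [MeasurableSpace X] {H : Set (X → Bool)}
    (hmeas : ∀ h ∈ H, Measurable h) (hVC : FiniteVCDim H) (hH : H.Nonempty)
    {𝓟 : Set (ProbabilityMeasure (X × Bool))}
    (hclass : ∀ P ∈ 𝓟, IsMeasurableClass H (marginal P)) :
    ∃ C : ℝ, 0 < C ∧ ∀ ℓ : ℕ, 1 ≤ ℓ → minimaxSL H 𝓟 ℓ ≤ ENNReal.ofReal (C * (1 / √ℓ)) := by
  obtain ⟨A, hA⟩ := exists_packing_exponent hVC
  -- The factor `√2` arises because the process lives on `2ℓ` points.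
  refine ⟨(22 * A + 12) * √2, by positivity, fun ℓ hℓ => ?_⟩
  choose f hf using fun (n : ℕ) (S : Fin n → X × Bool) => exists_errorCount_minimizer hH S
  refine iInf_le_of_le f (iSup₂_le fun P hP => ?_)
  obtain ⟨g, hg, hle, hgint⟩ :=
    exists_measurable_ge_ghostDeviation hH (hclass P hP) hℓ (fun x => hA ℓ x hℓ)
  refine (expectation_excessRisk_minimizer_le hmeas hH P hℓ hg hle (f ℓ) (hf ℓ)).trans ?_
  have hpos : (0 : ℝ) < ℓ := by exact_mod_cast hℓ
  refine (ENNReal.div_le_div_right hgint _).trans ?_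
  rw [← ENNReal.ofReal_natCast, ← ENNReal.ofReal_div_of_pos hpos]
  refine ENNReal.ofReal_le_ofReal (le_of_eq ?_)
  rw [← two_mul, Real.sqrt_mul (by norm_num)]
  have : √(ℓ : ℝ) ^ 2 = ℓ := Real.sq_sqrt hpos.le
  have h0 : √(ℓ : ℝ) ≠ 0 := by positivity
  field_simp
  rw [this]

/-! ### Product densities and laws with a given labeling function -/

theorem pi_withDensity {ι α : Type*} [Fintype ι] [MeasurableSpace α] (P : Measure α)
    [IsProbabilityMeasure P] {q : α → ℝ≥0∞} (hq : Measurable q) [SigmaFinite (P.withDensity q)] :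
    (Measure.pi fun _ : ι => P.withDensity q)
      = (Measure.pi fun _ : ι => P).withDensity fun ω => ∏ i, q (ω i) := by
  refine Measure.pi_eq fun s hs => ?_
  rw [withDensity_apply _ (MeasurableSet.univ_pi hs),
    ← lintegral_indicator (MeasurableSet.univ_pi hs)]
  have h1 : ∀ ω : ι → α, (Set.univ.pi s).indicator (fun ω => ∏ i, q (ω i)) ω
      = ∏ i, (s i).indicator q (ω i) := by
    intro ω
    by_cases h : ω ∈ Set.univ.pi s
    · rw [Set.indicator_of_mem h]
      exact Finset.prod_congr rfl fun i _ => (Set.indicator_of_mem (h i trivial) _).symm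
    · rw [Set.indicator_of_notMem h]
      simp only [Set.mem_univ_pi, not_forall] at h
      obtain ⟨i, hi⟩ := h
      exact (Finset.prod_eq_zero (Finset.mem_univ i) (Set.indicator_of_notMem hi _)).symm
  have hm : ∀ i, Measurable ((s i).indicator q) := fun i => hq.indicator (hs i)
  simp_rw [h1]
  rw [ProbabilityTheory.lintegral_prod_eq_prod_lintegral_of_indepFun Finset.univ
    (fun i (ω : ι → α) => (s i).indicator q (ω i))
    (ProbabilityTheory.iIndepFun_pi fun i => (hm i).aemeasurable)
    fun i => (hm i).comp (measurable_pi_apply i)]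
  refine Finset.prod_congr rfl fun i _ => ?_
  have := (measurePreserving_eval (fun _ : ι => P) i).lintegral_comp (hm i)
  rw [withDensity_apply _ (hs i), ← lintegral_indicator (hs i)]
  exact this

theorem measure_prod_bool_eq {X : Type*} [MeasurableSpace X] (ν : Measure (X × Bool))
    {E : Set (X × Bool)} (hE : MeasurableSet E) :
    ν E = ν ({x | (x, true) ∈ E} ×ˢ {true}) + ν ({x | (x, false) ∈ E} ×ˢ {false}) := by
  have h : ∀ b : Bool, MeasurableSet ({x | (x, b) ∈ E} ×ˢ {b}) := fun b =>
    (measurable_prodMk_right hE).prod (measurableSet_singleton b)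
  rw [← measure_union _ (h false)]
  · congr 1
    ext ⟨x, b⟩
    cases b <;> simp
  · rw [Set.disjoint_left]
    rintro ⟨x, b⟩ h1 h2
    simp only [Set.mem_prod, Set.mem_singleton_iff] at h1 h2
    exact absurd (h1.2.symm.trans h2.2) (by simp)

/-- The conditional probability of the label `b` under the labeling function `η`. -/
def labelProb {X : Type*} (η : X → ℝ) (p : X × Bool) : ℝ := if p.2 = true then η p.1 else 1 - η p.1

theorem measurable_labelProb {X : Type*} [MeasurableSpace X] {η : X → ℝ} (hη : Measurable η) :
    Measurable (labelProb η) :=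
  Measurable.ite (measurable_snd (measurableSet_singleton true)) (hη.comp measurable_fst)
    (measurable_const.sub (hη.comp measurable_fst))

/-- The distribution with marginal `μ` and labeling function `η`. -/
noncomputable def pairing {X : Type*} [MeasurableSpace X] (μ : Measure X) (η : X → ℝ) :
    Measure (X × Bool) :=
  (μ.prod Measure.count).withDensity fun p => ENNReal.ofReal (labelProb η p)

theorem pairing_prod_singleton {X : Type*} [MeasurableSpace X] (μ : Measure X) [SigmaFinite μ]
    {η : X → ℝ} (hη : Measurable η) {B : Set X} (hB : MeasurableSet B) (b : Bool) :
    pairing μ η (B ×ˢ {b}) = ∫⁻ x in B, ENNReal.ofReal (labelProb η (x, b)) ∂μ := by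
  have hm : Measurable fun p => ENNReal.ofReal (labelProb η p) :=
    ENNReal.measurable_ofReal.comp (measurable_labelProb hη)
  rw [pairing, withDensity_apply _ (hB.prod (measurableSet_singleton b)), ← Measure.prod_restrict,
    lintegral_prod _ hm.aemeasurable]
  simp [Measure.restrict_singleton]

theorem measure_ext_prod_bool {X : Type*} [MeasurableSpace X] {ν ν' : Measure (X × Bool)}
    (h : ∀ B, MeasurableSet B → ∀ b : Bool, ν (B ×ˢ {b}) = ν' (B ×ˢ {b})) : ν = ν' := by
  refine Measure.ext fun E hE => ?_
  rw [measure_prod_bool_eq ν hE, measure_prod_bool_eq ν' hE,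
    h {x | (x, true) ∈ E} (measurable_prodMk_right hE),
    h {x | (x, false) ∈ E} (measurable_prodMk_right hE)]

theorem setLIntegral_labelProb_add {X : Type*} [MeasurableSpace X] (μ : Measure X) {η : X → ℝ}
    (hη : Measurable η) (h0 : ∀ x, 0 ≤ η x) (h1 : ∀ x, η x ≤ 1) (B : Set X) :
    ∫⁻ x in B, ENNReal.ofReal (labelProb η (x, true)) ∂μ
      + ∫⁻ x in B, ENNReal.ofReal (labelProb η (x, false)) ∂μ = μ B := by
  have hm : ∀ b, Measurable fun x => ENNReal.ofReal (labelProb η (x, b)) := fun b =>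
    ENNReal.measurable_ofReal.comp ((measurable_labelProb hη).comp measurable_prodMk_right)
  rw [← lintegral_add_left (hm true)]
  have : ∀ x, ENNReal.ofReal (labelProb η (x, true)) + ENNReal.ofReal (labelProb η (x, false))
      = 1 := by
    intro x
    have : labelProb η (x, true) = η x := by simp [labelProb]
    have h' : labelProb η (x, false) = 1 - η x := by simp [labelProb]
    rw [this, h', ← ENNReal.ofReal_add (h0 x) (by linarith [h1 x])]
    simp
  simp [this]

theorem isProbabilityMeasure_pairing {X : Type*} [MeasurableSpace X] (μ : Measure X)
    [IsProbabilityMeasure μ] {η : X → ℝ} (hη : Measurable η) (h0 : ∀ x, 0 ≤ η x)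
    (h1 : ∀ x, η x ≤ 1) : IsProbabilityMeasure (pairing μ η) := by
  refine ⟨?_⟩
  rw [measure_prod_bool_eq _ MeasurableSet.univ]
  have : ∀ b : Bool, {x : X | (x, b) ∈ Set.univ} = Set.univ := fun b => by simp
  rw [this, this, pairing_prod_singleton μ hη MeasurableSet.univ,
    pairing_prod_singleton μ hη MeasurableSet.univ, setLIntegral_labelProb_add μ hη h0 h1,
    measure_univ]

/-- The slices with label `true` are prescribed, and those with label `false` follow by subtracting
finite masses from the marginal. -/
theorem IsPairing.eq_pairing {X : Type*} [MeasurableSpace X] {P : ProbabilityMeasure (X × Bool)}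
    {μ : Measure X} [IsProbabilityMeasure μ] {η : X → ℝ} (hP : IsPairing P μ η)
    (hη : Measurable η) (h0 : ∀ x, 0 ≤ η x) (h1 : ∀ x, η x ≤ 1) :
    (P : Measure (X × Bool)) = pairing μ η := by
  have htrue : ∀ B, MeasurableSet B →
      (P : Measure (X × Bool)) (B ×ˢ {true}) = pairing μ η (B ×ˢ {true}) := by
    intro B hB
    rw [hP.2 B hB, pairing_prod_singleton μ hη hB]
    simp [labelProb]
  refine measure_ext_prod_bool fun B hB b => ?_
  cases b
  · have h2 : (P : Measure (X × Bool)) (B ×ˢ {true}) + (P : Measure (X × Bool)) (B ×ˢ {false})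
        = μ B := by
      have h3 : μ B = (P : Measure (X × Bool)) (Prod.fst ⁻¹' B) := by
        rw [← hP.1, marginal, Measure.fst_apply hB]
      rw [h3, measure_prod_bool_eq _ (measurable_fst hB)]
      rfl
    rw [htrue B hB, ← setLIntegral_labelProb_add μ hη h0 h1 B, pairing_prod_singleton μ hη hB] at h2
    rw [pairing_prod_singleton μ hη hB]
    refine (ENNReal.add_right_inj ?_).1 h2
    rw [← pairing_prod_singleton μ hη hB]
    have := isProbabilityMeasure_pairing μ hη h0 h1
    exact measure_ne_top _ _
  · exact htrue B hB

/-! ### The two-point method -/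

/-- With `s = a + b`, the minimum is at least `ab / s ≥ 3 / (4s)`, and the arithmetic-geometric mean
inequality gives `3 / (4s) + 3s / 16 ≥ 3 / 4`. The slope `3 / 16` is tuned to `s = 2`, the mean of
`a + b` for two densities. -/
theorem two_point_mass_le {a b : ℝ} (ha : 0 ≤ a) (hb : 0 ≤ b) (hab : 3 / 4 ≤ a * b) :
    3 / 4 ≤ min a b + 3 / 16 * (a + b) := by
  have hs : 0 < a + b := by
    by_contra! h
    have : a = 0 := by linarith
    rw [this] at hab
    norm_num at hab
  rcases le_total a b with h | h
  · rw [min_eq_left h]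
    by_contra! hc
    nlinarith [sq_nonneg (a + b - 2), mul_pos hs (sub_pos.2 hc)]
  · rw [min_eq_right h]
    by_contra! hc
    nlinarith [sq_nonneg (a + b - 2), mul_pos hs (sub_pos.2 hc)]

/-- Two-point lower bound: two i.i.d. laws whose densities have a product close to `1` cannot be
told apart. -/
theorem two_point_lower_bound {α : Type*} [MeasurableSpace α] {n : ℕ}
    (P₀ P₁ P₂ : Measure α) [IsProbabilityMeasure P₀] [IsProbabilityMeasure P₁]
    [IsProbabilityMeasure P₂] {q₁ q₂ : α → ℝ} (hm₁ : Measurable q₁) (hm₂ : Measurable q₂)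
    (h₁ : ∀ x, 0 ≤ q₁ x) (h₂ : ∀ x, 0 ≤ q₂ x)
    (hP₁ : P₁ = P₀.withDensity fun x => ENNReal.ofReal (q₁ x))
    (hP₂ : P₂ = P₀.withDensity fun x => ENNReal.ofReal (q₂ x))
    {δ : ℝ} (hδ : δ ≤ 1) (hδn : n * δ ≤ 1 / 4) (hq : ∀ x, 1 - δ ≤ q₁ x * q₂ x)
    {G₁ G₂ : (Fin n → α) → ℝ≥0∞} (hG₁ : Measurable G₁) (hG₂ : Measurable G₂) {c : ℝ≥0∞}
    (hc : ∀ ω, c ≤ G₁ ω + G₂ ω) :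
    c * ENNReal.ofReal (3 / 8) ≤ ∫⁻ ω, G₁ ω ∂(Measure.pi fun _ => P₁)
      + ∫⁻ ω, G₂ ω ∂(Measure.pi fun _ => P₂) := by
  set μ : Measure (Fin n → α) := Measure.pi fun _ => P₀
  have hme : ∀ {q : α → ℝ}, Measurable q → Measurable fun x => ENNReal.ofReal (q x) :=
    fun h => ENNReal.measurable_ofReal.comp h
  set D₁ : (Fin n → α) → ℝ≥0∞ := fun ω => ∏ i, ENNReal.ofReal (q₁ (ω i)) with hD₁
  set D₂ : (Fin n → α) → ℝ≥0∞ := fun ω => ∏ i, ENNReal.ofReal (q₂ (ω i)) with hD₂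
  have hDm₁ : Measurable D₁ :=
    Finset.measurable_prod _ fun i _ => (hme hm₁).comp (measurable_pi_apply i)
  have hDm₂ : Measurable D₂ :=
    Finset.measurable_prod _ fun i _ => (hme hm₂).comp (measurable_pi_apply i)
  have hpi₁ : (Measure.pi fun _ : Fin n => P₁) = μ.withDensity D₁ := by
    subst hP₁
    exact pi_withDensity P₀ (hme hm₁)
  have hpi₂ : (Measure.pi fun _ : Fin n => P₂) = μ.withDensity D₂ := by
    subst hP₂
    exact pi_withDensity P₀ (hme hm₂)
  have hgint₁ : ∫⁻ ω, D₁ ω ∂μ = 1 := by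
    rw [← setLIntegral_univ, ← withDensity_apply _ MeasurableSet.univ, ← hpi₁, measure_univ]
  have hgint₂ : ∫⁻ ω, D₂ ω ∂μ = 1 := by
    rw [← setLIntegral_univ, ← withDensity_apply _ MeasurableSet.univ, ← hpi₂, measure_univ]
  have hpt : ∀ ω, ENNReal.ofReal (3 / 4)
      ≤ min (D₁ ω) (D₂ ω) + ENNReal.ofReal (3 / 16) * (D₁ ω + D₂ ω) := by
    intro ω
    have e₁ : D₁ ω = ENNReal.ofReal (∏ i, q₁ (ω i)) :=
      (ENNReal.ofReal_prod_of_nonneg fun i _ => h₁ _).symm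
    have e₂ : D₂ ω = ENNReal.ofReal (∏ i, q₂ (ω i)) :=
      (ENNReal.ofReal_prod_of_nonneg fun i _ => h₂ _).symm
    have p₁ : 0 ≤ ∏ i, q₁ (ω i) := Finset.prod_nonneg fun i _ => h₁ _
    have p₂ : 0 ≤ ∏ i, q₂ (ω i) := Finset.prod_nonneg fun i _ => h₂ _
    rw [e₁, e₂, ← ENNReal.ofReal_min, ← ENNReal.ofReal_add p₁ p₂,
      ← ENNReal.ofReal_mul (by norm_num), ← ENNReal.ofReal_add (le_min p₁ p₂) (by positivity)]
    refine ENNReal.ofReal_le_ofReal (two_point_mass_le p₁ p₂ ?_)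
    rw [← Finset.prod_mul_distrib]
    -- Bernoulli's inequality keeps the product of the two likelihood ratios above `3 / 4` at every
    -- sample point.
    calc (3 / 4 : ℝ) ≤ 1 + n * (-δ) := by linarith
      _ ≤ (1 + -δ) ^ n := one_add_mul_le_pow (by linarith) n
      _ = ∏ _i : Fin n, (1 - δ) := by simp [sub_eq_add_neg]
      _ ≤ _ := Finset.prod_le_prod (fun i _ => by linarith) fun i _ => hq _
  have hmin : ENNReal.ofReal (3 / 8) ≤ ∫⁻ ω, min (D₁ ω) (D₂ ω) ∂μ := by
    have h := lintegral_mono (μ := μ) hpt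
    rw [lintegral_const, measure_univ, mul_one, lintegral_add_left (hDm₁.min hDm₂),
      lintegral_const_mul _ (f := fun ω => D₁ ω + D₂ ω) (hDm₁.add hDm₂),
      lintegral_add_left hDm₁, hgint₁, hgint₂,
      ← ENNReal.ofReal_one, ← ENNReal.ofReal_add (by norm_num) (by norm_num),
      ← ENNReal.ofReal_mul (by norm_num)] at h
    have h' : ENNReal.ofReal (3 / 8) + ENNReal.ofReal (3 / 16 * (1 + 1))
        ≤ ∫⁻ ω, min (D₁ ω) (D₂ ω) ∂μ + ENNReal.ofReal (3 / 16 * (1 + 1)) := by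
      rw [← ENNReal.ofReal_add (by norm_num) (by norm_num)]
      convert h using 2
      norm_num
    exact (ENNReal.add_le_add_iff_right ENNReal.ofReal_ne_top).1 h'
  rw [hpi₁, hpi₂, lintegral_withDensity_eq_lintegral_mul _ hDm₁ hG₁,
    lintegral_withDensity_eq_lintegral_mul _ hDm₂ hG₂, ← lintegral_add_left (hDm₁.mul hG₁)]
  calc c * ENNReal.ofReal (3 / 8) ≤ c * ∫⁻ ω, min (D₁ ω) (D₂ ω) ∂μ := by gcongr
    _ = ∫⁻ ω, c * min (D₁ ω) (D₂ ω) ∂μ := (lintegral_const_mul _ (hDm₁.min hDm₂)).symm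
    _ ≤ _ := by
      refine lintegral_mono fun ω => ?_
      calc c * min (D₁ ω) (D₂ ω) ≤ (G₁ ω + G₂ ω) * min (D₁ ω) (D₂ ω) := by gcongr; exact hc ω
        _ = min (D₁ ω) (D₂ ω) * G₁ ω + min (D₁ ω) (D₂ ω) * G₂ ω := by ring
        _ ≤ D₁ ω * G₁ ω + D₂ ω * G₂ ω := by
          gcongr
          exacts [min_le_left _ _, min_le_right _ _]

theorem le_expectation_add_expectation {Ω : Type*} [MeasurableSpace Ω] {μ ν : Measure Ω}
    {f₁ f₂ : Ω → ℝ≥0∞} {c : ℝ≥0∞}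
    (h : ∀ G₁ G₂ : Ω → ℝ≥0∞, Measurable G₁ → Measurable G₂ → (∀ ω, f₁ ω ≤ G₁ ω) →
      (∀ ω, f₂ ω ≤ G₂ ω) → c ≤ ∫⁻ ω, G₁ ω ∂μ + ∫⁻ ω, G₂ ω ∂ν) :
    c ≤ expectation μ f₁ + expectation ν f₂ := by
  simp only [expectation, ENNReal.iInf_add, ENNReal.add_iInf]
  refine le_iInf fun G₂ => le_iInf fun m₂ => le_iInf fun l₂ => le_iInf fun G₁ => le_iInf fun m₁ =>
    le_iInf fun l₁ => ?_
  exact h G₁ G₂ m₁ m₂ l₁ l₂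

/-! ### Lower bound for rich families -/

section Rich

variable {X : Type*} {h h' : X → Bool}

theorem richLabeling_nonneg {α : ℝ} (hα : -(1 / 2) ≤ α) (x : X) : 0 ≤ richLabeling h h' α x := by
  unfold richLabeling
  split_ifs <;> linarith

theorem richLabeling_le_one {α : ℝ} (hα : α ≤ 1 / 2) (x : X) : richLabeling h h' α x ≤ 1 := by
  unfold richLabeling
  split_ifs <;> linarith

theorem richLabeling_swap (α : ℝ) : richLabeling h h' α = richLabeling h' h α := by
  funext x
  unfold richLabeling
  cases h x <;> cases h' x <;> simp

/-- The density of the rich distribution with bias `α` relative to the unbiased one. -/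
noncomputable def richDensity (h h' : X → Bool) (α : ℝ) (p : X × Bool) : ℝ :=
  if h p.1 ≠ h' p.1 then 1 + 2 * α * boolSign p.2 else 1

theorem richDensity_nonneg {α : ℝ} (h1 : -(1 / 2) ≤ α) (h2 : α ≤ 1 / 2) (p : X × Bool) :
    0 ≤ richDensity h h' α p := by
  unfold richDensity boolSign
  split_ifs <;> linarith

/-- On the disagreement set the product is `(1 + 2α)(1 - 2α)`: the first-order terms cancel, which
is why a bias of order `1/√ℓ` stays hidden. -/
theorem le_richDensity_mul (α : ℝ) (p : X × Bool) :
    1 - 4 * α ^ 2 ≤ richDensity h h' α p * richDensity h h' (-α) p := by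
  unfold richDensity boolSign
  split_ifs <;> nlinarith [sq_nonneg α]

variable [MeasurableSpace X]

theorem measurableSet_disagree (hh : Measurable h) (hh' : Measurable h') :
    MeasurableSet {x | h x ≠ h' x} := (measurableSet_eq_fun hh hh').compl

theorem measurable_richLabeling (hh : Measurable h) (hh' : Measurable h') (α : ℝ) :
    Measurable (richLabeling h h' α) := by
  refine Measurable.ite (measurableSet_disagree hh hh') measurable_const ?_
  exact Measurable.ite (hh (measurableSet_singleton true)) measurable_const measurable_const

theorem measurable_richDensity (hh : Measurable h) (hh' : Measurable h') (α : ℝ) :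
    Measurable (richDensity h h' α) := by
  refine Measurable.ite (measurable_fst (measurableSet_disagree hh hh')) ?_ measurable_const
  have : Measurable boolSign := .of_discrete
  exact measurable_const.add (measurable_const.mul (this.comp measurable_snd))

theorem pairing_richLabeling_eq_withDensity (μ : Measure X) (hh : Measurable h)
    (hh' : Measurable h') (α : ℝ) :
    pairing μ (richLabeling h h' α) = (pairing μ (richLabeling h h' 0)).withDensity
      fun p => ENNReal.ofReal (richDensity h h' α p) := by
  have hm : ∀ α, Measurable fun p => ENNReal.ofReal (labelProb (richLabeling h h' α) p) :=
    fun α => ENNReal.measurable_ofReal.comp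
      (measurable_labelProb (measurable_richLabeling hh hh' α))
  unfold pairing
  rw [← withDensity_mul _ (hm 0) (g := fun p => ENNReal.ofReal (richDensity h h' α p))
    (ENNReal.measurable_ofReal.comp (measurable_richDensity hh hh' α))]
  congr 1
  funext p
  rw [Pi.mul_apply, ← ENNReal.ofReal_mul]
  · congr 1
    obtain ⟨x, b⟩ := p
    cases b <;> simp only [labelProb, richLabeling, richDensity, boolSign] <;> split_ifs <;>
      simp_all <;> ring
  · obtain ⟨x, b⟩ := p
    cases b <;> simp only [labelProb, richLabeling] <;> split_ifs <;> norm_num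

/-- At each point of disagreement `f` rejects one label, and the probabilities of that label under
the biases `α` and `-α` add up to `1`. -/
theorem measure_disagree_le_risk_add (μ : Measure X) [IsProbabilityMeasure μ]
    (hh : Measurable h) (hh' : Measurable h')
    {α : ℝ} (h1 : -(1 / 2) ≤ α) (h2 : α ≤ 1 / 2) {P Q : ProbabilityMeasure (X × Bool)}
    (hP : (P : Measure (X × Bool)) = pairing μ (richLabeling h h' α))
    (hQ : (Q : Measure (X × Bool)) = pairing μ (richLabeling h h' (-α))) (f : X → Bool) :
    μ {x | h x ≠ h' x} ≤ risk P f + risk Q f := by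
  set D := {x | h x ≠ h' x} with hD
  have hDm : MeasurableSet D := measurableSet_disagree hh hh'
  set E : Set (X × Bool) := {p | f p.1 ≠ p.2} with hE
  -- The classifier `f` may be nonmeasurable, so its error set is replaced by a measurable hull of
  -- the same mass under both laws.
  set E' := toMeasurable (P : Measure (X × Bool)) E ∩ toMeasurable (Q : Measure (X × Bool)) E
  have hE'm : MeasurableSet E' :=
    (measurableSet_toMeasurable _ _).inter (measurableSet_toMeasurable _ _)
  have hEE' : E ⊆ E' := Set.subset_inter (subset_toMeasurable _ _) (subset_toMeasurable _ _)
  have hPE : (P : Measure (X × Bool)) E' ≤ risk P f :=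
    (measure_mono Set.inter_subset_left).trans (measure_toMeasurable _).le
  have hQE : (Q : Measure (X × Bool)) E' ≤ risk Q f :=
    (measure_mono Set.inter_subset_right).trans (measure_toMeasurable _).le
  refine le_trans ?_ (add_le_add hPE hQE)
  have hBm : ∀ b : Bool, MeasurableSet {x | (x, b) ∈ E'} := fun b => measurable_prodMk_right hE'm
  have hsub : ∀ b : Bool, MeasurableSet (D ∩ {x | (x, b) ∈ E'}) := fun b => hDm.inter (hBm b)
  have hsum : ∀ b : Bool, μ (D ∩ {x | (x, b) ∈ E'})
      ≤ (P : Measure (X × Bool)) ({x | (x, b) ∈ E'} ×ˢ {b})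
        + (Q : Measure (X × Bool)) ({x | (x, b) ∈ E'} ×ˢ {b}) := by
    intro b
    have hmono : (D ∩ {x | (x, b) ∈ E'}) ×ˢ ({b} : Set Bool) ⊆ {x | (x, b) ∈ E'} ×ˢ {b} :=
      Set.prod_mono_left Set.inter_subset_right
    refine le_trans ?_ (add_le_add (measure_mono hmono) (measure_mono hmono))
    rw [hP, hQ, pairing_prod_singleton μ (measurable_richLabeling hh hh' _) (hsub b),
      pairing_prod_singleton μ (measurable_richLabeling hh hh' _) (hsub b),
      ← lintegral_add_left (f := fun x => ENNReal.ofReal (labelProb (richLabeling h h' α) (x, b)))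
        (ENNReal.measurable_ofReal.comp ((measurable_labelProb
        (measurable_richLabeling hh hh' _)).comp measurable_prodMk_right)), ← setLIntegral_one]
    refine setLIntegral_mono' (hsub b) fun x hx => ?_
    have hx' : h x ≠ h' x := hx.1
    have hη : ∀ α, richLabeling h h' α x = 1 / 2 + α := fun α => by simp [richLabeling, hx']
    rw [← ENNReal.ofReal_add, ← ENNReal.ofReal_one]
    · refine ENNReal.ofReal_le_ofReal ?_
      cases b <;> simp only [labelProb, hη] <;> norm_num <;> linarith
    · cases b <;> simp only [labelProb, hη] <;> norm_num <;> linarith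
    · cases b <;> simp only [labelProb, hη] <;> norm_num <;> linarith
  have hcover : D ⊆ (D ∩ {x | (x, true) ∈ E'}) ∪ (D ∩ {x | (x, false) ∈ E'}) := by
    intro x hx
    cases hfx : f x
    · exact Or.inl ⟨hx, hEE' (show f x ≠ true by simp [hfx])⟩
    · exact Or.inr ⟨hx, hEE' (show f x ≠ false by simp [hfx])⟩
  calc μ D ≤ μ (D ∩ {x | (x, true) ∈ E'}) + μ (D ∩ {x | (x, false) ∈ E'}) :=
        (measure_mono hcover).trans (measure_union_le _ _)
    _ ≤ _ := add_le_add (hsum true) (hsum false)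
    _ = _ := by
      rw [measure_prod_bool_eq (P : Measure (X × Bool)) hE'm,
        measure_prod_bool_eq (Q : Measure (X × Bool)) hE'm]
      ring

theorem risk_eq_lintegral (μ : Measure X) [IsProbabilityMeasure μ] {η : X → ℝ}
    (hη : Measurable η) {P : ProbabilityMeasure (X × Bool)}
    (hP : (P : Measure (X × Bool)) = pairing μ η) {f : X → Bool} (hf : Measurable f) :
    risk P f = ∫⁻ x, ENNReal.ofReal (labelProb η (x, !f x)) ∂μ := by
  rw [risk, measure_prod_bool_eq _ (measurableSet_error hf), hP]
  have e1 : {x | (x, true) ∈ {p : X × Bool | f p.1 ≠ p.2}} = {x | f x = true}ᶜ := by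
    ext x; simp
  have e2 : {x | (x, false) ∈ {p : X × Bool | f p.1 ≠ p.2}} = {x | f x = true} := by
    ext x; simp
  have hm : MeasurableSet {x | f x = true} := hf (measurableSet_singleton true)
  rw [e1, e2, pairing_prod_singleton μ hη hm.compl, pairing_prod_singleton μ hη hm,
    ← lintegral_add_compl (fun x => ENNReal.ofReal (labelProb η (x, !f x))) hm, add_comm]
  congr 1
  · refine setLIntegral_congr_fun hm fun x hx => ?_
    have : f x = true := hx
    simp [this]
  · refine setLIntegral_congr_fun hm.compl fun x hx => ?_
    have : f x = false := by simpa using hx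
    simp [this]

theorem lintegral_two_indicators (μ : Measure X) {s t : Set X} (hs : MeasurableSet s)
    (ht : MeasurableSet t) (a b : ℝ≥0∞) :
    ∫⁻ x, (s.indicator (fun _ => a) x + t.indicator (fun _ => b) x) ∂μ = a * μ s + b * μ t := by
  rw [lintegral_add_left (measurable_const.indicator hs), lintegral_indicator_const hs,
    lintegral_indicator_const ht]

theorem measurableSet_disagree_and (hh : Measurable h) (hh' : Measurable h') (b : Bool) :
    MeasurableSet {x | h x ≠ h' x ∧ h x = b} :=
  (measurableSet_disagree hh hh').inter (hh (measurableSet_singleton b))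

theorem risk_rich_left (μ : Measure X) [IsProbabilityMeasure μ] (hh : Measurable h)
    (hh' : Measurable h') {α : ℝ} {P : ProbabilityMeasure (X × Bool)}
    (hP : (P : Measure (X × Bool)) = pairing μ (richLabeling h h' α)) :
    risk P h = ENNReal.ofReal (1 / 2 - α) * μ {x | h x ≠ h' x ∧ h x = true}
      + ENNReal.ofReal (1 / 2 + α) * μ {x | h x ≠ h' x ∧ h x = false} := by
  rw [risk_eq_lintegral μ (measurable_richLabeling hh hh' α) hP hh,
    ← lintegral_two_indicators μ (measurableSet_disagree_and hh hh' true)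
      (measurableSet_disagree_and hh hh' false)]
  refine lintegral_congr fun x => ?_
  simp only [Set.indicator_apply, Set.mem_ofPred_eq, labelProb, richLabeling]
  rcases Bool.eq_false_or_eq_true (h x) with e | e <;>
    rcases Bool.eq_false_or_eq_true (h' x) with e' | e' <;> simp [e, e']
  congr 1
  ring

/-- Changing the sign of the bias and exchanging the classifiers compensate: this is the same value
as for `h` under bias `α`. -/
theorem risk_rich_right (μ : Measure X) [IsProbabilityMeasure μ] (hh : Measurable h)
    (hh' : Measurable h') {α : ℝ} {P : ProbabilityMeasure (X × Bool)}
    (hP : (P : Measure (X × Bool)) = pairing μ (richLabeling h h' (-α))) :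
    risk P h' = ENNReal.ofReal (1 / 2 - α) * μ {x | h x ≠ h' x ∧ h x = true}
      + ENNReal.ofReal (1 / 2 + α) * μ {x | h x ≠ h' x ∧ h x = false} := by
  rw [risk_eq_lintegral μ (measurable_richLabeling hh hh' _) hP hh',
    ← lintegral_two_indicators μ (measurableSet_disagree_and hh hh' true)
      (measurableSet_disagree_and hh hh' false)]
  refine lintegral_congr fun x => ?_
  simp only [Set.indicator_apply, Set.mem_ofPred_eq, labelProb, richLabeling]
  rcases Bool.eq_false_or_eq_true (h x) with e | e <;>
    rcases Bool.eq_false_or_eq_true (h' x) with e' | e' <;> simp [e, e'] <;> ring_nf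

/-- No classifier is good for both signs of the bias. -/
theorem le_excessRisk_add_excessRisk (μ : Measure X) [IsProbabilityMeasure μ]
    {H : Set (X → Bool)} (hH : h ∈ H) (hH' : h' ∈ H) (hh : Measurable h) (hh' : Measurable h')
    {α : ℝ} (h1 : 0 ≤ α) (h2 : α ≤ 1 / 2)
    (hlt : μ.real {x | h x ≠ h' x ∧ h x = false} ≤ μ.real {x | h x ≠ h' x ∧ h x = true})
    {P Q : ProbabilityMeasure (X × Bool)}
    (hP : (P : Measure (X × Bool)) = pairing μ (richLabeling h h' α))
    (hQ : (Q : Measure (X × Bool)) = pairing μ (richLabeling h h' (-α))) (f : X → Bool) :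
    ENNReal.ofReal (2 * α * (μ.real {x | h x ≠ h' x ∧ h x = true}
      - μ.real {x | h x ≠ h' x ∧ h x = false})) ≤ excessRisk P H f + excessRisk Q H f := by
  have hD : {x | h x ≠ h' x} = {x | h x ≠ h' x ∧ h x = true} ∪ {x | h x ≠ h' x ∧ h x = false} := by
    ext x
    cases hx : h x <;> simp [hx]
  have hdisj : Disjoint {x | h x ≠ h' x ∧ h x = true} {x | h x ≠ h' x ∧ h x = false} := by
    rw [Set.disjoint_left]
    rintro x ⟨_, hx⟩ ⟨_, hx'⟩
    exact absurd (hx.symm.trans hx') (by simp)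
  have hμ := measure_disagree_le_risk_add μ hh hh' (by linarith) h2 hP hQ f
  rw [hD, measure_union hdisj (measurableSet_disagree_and hh hh' false)] at hμ
  have hr₁ := risk_rich_left μ hh hh' hP
  have hr₂ := risk_rich_right μ hh hh' hQ
  set m₁ := μ.real {x | h x ≠ h' x ∧ h x = true} with hm₁
  set m₀ := μ.real {x | h x ≠ h' x ∧ h x = false} with hm₀
  have e₁ : μ {x | h x ≠ h' x ∧ h x = true} = ENNReal.ofReal m₁ :=
    (ENNReal.ofReal_toReal (measure_ne_top _ _)).symm
  have e₀ : μ {x | h x ≠ h' x ∧ h x = false} = ENNReal.ofReal m₀ :=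
    (ENNReal.ofReal_toReal (measure_ne_top _ _)).symm
  have p₁ : 0 ≤ m₁ := measureReal_nonneg
  have p₀ : 0 ≤ m₀ := measureReal_nonneg
  have q : 0 ≤ 1 / 2 - α := by linarith
  rw [e₁, e₀, ← ENNReal.ofReal_mul q, ← ENNReal.ofReal_mul (by positivity),
    ← ENNReal.ofReal_add (by positivity) (by positivity)] at hr₁ hr₂
  rw [e₁, e₀, ← ENNReal.ofReal_add p₁ p₀] at hμ
  set r := (1 / 2 - α) * m₁ + (1 / 2 + α) * m₀ with hr
  have hrn : 0 ≤ r := by positivity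
  have hbP : bestRisk P H ≤ ENNReal.ofReal r := (iInf₂_le h hH).trans hr₁.le
  have hbQ : bestRisk Q H ≤ ENNReal.ofReal r := (iInf₂_le h' hH').trans hr₂.le
  have hfP : risk P f ≤ excessRisk P H f + ENNReal.ofReal r :=
    le_tsub_add.trans (add_le_add_right hbP _)
  have hfQ : risk Q f ≤ excessRisk Q H f + ENNReal.ofReal r :=
    le_tsub_add.trans (add_le_add_right hbQ _)
  -- The two reference risks are both `r`, and `m₁ + m₀ = 2r + 2α(m₁ - m₀)`.
  have key : ENNReal.ofReal (2 * α * (m₁ - m₀)) + ENNReal.ofReal (r + r)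
      ≤ excessRisk P H f + excessRisk Q H f + ENNReal.ofReal (r + r) := by
    rw [← ENNReal.ofReal_add (mul_nonneg (by positivity) (by linarith)) (by positivity)]
    calc _ = ENNReal.ofReal (m₁ + m₀) := by
          congr 1
          rw [hr]
          ring
      _ ≤ risk P f + risk Q f := hμ
      _ ≤ (excessRisk P H f + ENNReal.ofReal r) + (excessRisk Q H f + ENNReal.ofReal r) :=
          add_le_add hfP hfQ
      _ = _ := by
          rw [ENNReal.ofReal_add hrn hrn]
          ring
  exact (ENNReal.add_le_add_iff_right ENNReal.ofReal_ne_top).1 key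

theorem le_minimaxMarginal_of_rich {H : Set (X → Bool)} {𝓟 : Set (ProbabilityMeasure (X × Bool))}
    (hH : h ∈ H) (hH' : h' ∈ H) (hh : Measurable h) (hh' : Measurable h')
    (μ : ProbabilityMeasure X)
    (hlt : (μ : Measure X).real {x | h x ≠ h' x ∧ h x = false}
      < (μ : Measure X).real {x | h x ≠ h' x ∧ h x = true})
    (hrich : ∀ α : ℝ, 0 < α → α < 1 / 2 →
      (∃ P ∈ 𝓟, IsPairing P μ (richLabeling h h' α)) ∧
      (∃ P ∈ 𝓟, IsPairing P μ (richLabeling h h' (-α)))) :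
    ∃ c : ℝ, 0 < c ∧ ∀ ℓ : ℕ, 1 ≤ ℓ → ENNReal.ofReal (c * (1 / √ℓ)) ≤ minimaxMarginal H 𝓟 ℓ := by
  set Δ := (μ : Measure X).real {x | h x ≠ h' x ∧ h x = true}
    - (μ : Measure X).real {x | h x ≠ h' x ∧ h x = false} with hΔ
  have hΔpos : 0 < Δ := sub_pos.2 hlt
  -- Half of `2α * Δ * (3 / 8)` at `α = 1 / (4√ℓ)`; the half comes from the larger of two
  -- expectations.
  refine ⟨3 / 32 * Δ, by positivity, fun ℓ hℓ => ?_⟩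
  have hℓ' : (1 : ℝ) ≤ ℓ := by exact_mod_cast hℓ
  have hs : 1 ≤ √(ℓ : ℝ) := Real.one_le_sqrt.2 hℓ'
  have hsq : √(ℓ : ℝ) ^ 2 = ℓ := Real.sq_sqrt (by linarith)
  -- Chosen so that `ℓ * 4α² = 1 / 4`, the limit allowed by the two-point bound.
  set α : ℝ := 1 / (4 * √ℓ) with hα
  have hα0 : 0 < α := by positivity
  have hα2 : α ≤ 1 / 4 := by
    rw [hα]
    exact one_div_le_one_div_of_le (by norm_num) (by linarith)
  have hα3 : ℓ * (4 * α ^ 2) = 1 / 4 := by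
    rw [hα, div_pow, mul_pow, hsq]
    field_simp
  obtain ⟨⟨P, hP𝓟, hP⟩, Q, hQ𝓟, hQ⟩ := hrich α hα0 (by linarith)
  have hPe := hP.eq_pairing (measurable_richLabeling hh hh' _)
    (richLabeling_nonneg (by linarith)) (richLabeling_le_one (by linarith))
  have hQe := hQ.eq_pairing (measurable_richLabeling hh hh' _)
    (richLabeling_nonneg (by linarith)) (richLabeling_le_one (by linarith))
  refine le_iInf fun A => ?_
  set M := ⨆ P ∈ 𝓟, expectation (sampleLaw P ℓ) fun S => excessRisk P H (A ℓ S (marginal P))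
  have hMP : expectation (sampleLaw P ℓ) (fun S => excessRisk P H (A ℓ S μ)) ≤ M := by
    have := le_iSup₂ (f := fun (P : ProbabilityMeasure (X × Bool)) (_ : P ∈ 𝓟) =>
      expectation (sampleLaw P ℓ) fun S => excessRisk P H (A ℓ S (marginal P))) P hP𝓟
    simp only [hP.1] at this
    exact this
  have hMQ : expectation (sampleLaw Q ℓ) (fun S => excessRisk Q H (A ℓ S μ)) ≤ M := by
    have := le_iSup₂ (f := fun (P : ProbabilityMeasure (X × Bool)) (_ : P ∈ 𝓟) =>
      expectation (sampleLaw P ℓ) fun S => excessRisk P H (A ℓ S (marginal P))) Q hQ𝓟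
    simp only [hQ.1] at this
    exact this
  have hprob := isProbabilityMeasure_pairing (μ : Measure X)
    (measurable_richLabeling hh hh' 0) (richLabeling_nonneg (by norm_num))
    (richLabeling_le_one (by norm_num))
  have hsum : ENNReal.ofReal (2 * α * Δ) * ENNReal.ofReal (3 / 8) ≤ M + M := by
    refine le_trans ?_ (add_le_add hMP hMQ)
    refine le_expectation_add_expectation fun G₁ G₂ m₁ m₂ l₁ l₂ => ?_
    refine two_point_lower_bound (pairing (μ : Measure X) (richLabeling h h' 0)) P Q
      (measurable_richDensity hh hh' α) (measurable_richDensity hh hh' (-α))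
      (richDensity_nonneg (by linarith) (by linarith))
      (richDensity_nonneg (by linarith) (by linarith))
      (hPe.trans (pairing_richLabeling_eq_withDensity _ hh hh' _))
      (hQe.trans (pairing_richLabeling_eq_withDensity _ hh hh' _))
      (δ := 4 * α ^ 2) (by nlinarith) hα3.le (le_richDensity_mul α) m₁ m₂ fun S => ?_
    exact (le_excessRisk_add_excessRisk (μ : Measure X) hH hH' hh hh' hα0.le (by linarith) hlt.le
      hPe hQe (A ℓ S μ)).trans (add_le_add (l₁ S) (l₂ S))
  by_contra! hlt'
  have h3 := ENNReal.add_lt_add hlt' hlt'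
  rw [← ENNReal.ofReal_add (by positivity) (by positivity)] at h3
  rw [← ENNReal.ofReal_mul (by positivity)] at hsum
  have h4 : 2 * α * Δ * (3 / 8) = 3 / 32 * Δ * (1 / √ℓ) + 3 / 32 * Δ * (1 / √ℓ) := by
    rw [hα]
    field_simp
    norm_num
  rw [h4] at hsum
  exact absurd hsum (not_le.2 h3)

/-- The rich labeling is symmetric in `h` and `h'`, so they may be exchanged to make the mass where
`h` predicts `true` the larger one. -/
theorem exists_le_minimaxMarginal {H : Set (X → Bool)} {𝓟 : Set (ProbabilityMeasure (X × Bool))}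
    (hmeas : ∀ h ∈ H, Measurable h) (hrich : IsRich 𝓟 H) :
    ∃ c : ℝ, 0 < c ∧ ∀ ℓ : ℕ, 1 ≤ ℓ → ENNReal.ofReal (c * (1 / √ℓ)) ≤ minimaxMarginal H 𝓟 ℓ := by
  obtain ⟨h, hH, h', hH', μ, hne, hP⟩ := hrich
  have hne' : (μ : Measure X).real {x | h x ≠ h' x ∧ h x = false}
      ≠ (μ : Measure X).real {x | h x ≠ h' x ∧ h x = true} := fun e =>
    hne ((measureReal_eq_measureReal_iff).1 e)
  rcases hne'.lt_or_gt with hlt | hlt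
  · exact le_minimaxMarginal_of_rich hH hH' (hmeas h hH) (hmeas h' hH') μ hlt hP
  · refine le_minimaxMarginal_of_rich hH' hH (hmeas h' hH') (hmeas h hH) μ ?_ ?_
    · have e1 : {x | h' x ≠ h x ∧ h' x = false} = {x | h x ≠ h' x ∧ h x = true} := by
        ext x
        cases hx : h x <;> cases hx' : h' x <;> simp [hx, hx']
      have e2 : {x | h' x ≠ h x ∧ h' x = true} = {x | h x ≠ h' x ∧ h x = false} := by
        ext x
        cases hx : h x <;> cases hx' : h' x <;> simp [hx, hx']
      rw [e1, e2]
      exact hlt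
    · simpa only [richLabeling_swap (h := h') (h' := h)] using hP

theorem minimaxMarginal_le_minimaxSL (H : Set (X → Bool))
    (𝓟 : Set (ProbabilityMeasure (X × Bool))) (ℓ : ℕ) :
    minimaxMarginal H 𝓟 ℓ ≤ minimaxSL H 𝓟 ℓ :=
  le_iInf fun A => iInf_le_of_le (fun ℓ S _ => A ℓ S) le_rfl

end Rich

theorem not_tendsto_div_zero_of_hasRate {f g : ℕ → ℝ≥0∞} {c C : ℝ} (hc : 0 < c) (hC : 0 < C)
    (hf : ∀ ℓ : ℕ, 1 ≤ ℓ → ENNReal.ofReal (c * (1 / √ℓ)) ≤ f ℓ)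
    (hg : ∀ ℓ : ℕ, 1 ≤ ℓ → g ℓ ≤ ENNReal.ofReal (C * (1 / √ℓ))) :
    ¬ Filter.Tendsto (fun ℓ => f ℓ / g ℓ) Filter.atTop (nhds 0) := by
  intro h
  have hpos : (0 : ℝ≥0∞) < ENNReal.ofReal (c / C) := ENNReal.ofReal_pos.2 (by positivity)
  obtain ⟨N, hN⟩ := Filter.eventually_atTop.1 (h.eventually (gt_mem_nhds hpos))
  have h1 := hN (N + 1) (by omega)
  refine absurd h1 (not_lt.2 ?_)
  have hs : 0 < √((N + 1 : ℕ) : ℝ) := by positivity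
  calc ENNReal.ofReal (c / C)
      = ENNReal.ofReal (c * (1 / √((N + 1 : ℕ) : ℝ)))
        / ENNReal.ofReal (C * (1 / √((N + 1 : ℕ) : ℝ))) := by
        rw [← ENNReal.ofReal_div_of_pos (by positivity)]
        congr 1
        field_simp
    _ ≤ f (N + 1) / g (N + 1) := ENNReal.div_le_div (hf _ (by omega)) (hg _ (by omega))

end SSL

theorem mainTheorem4 {X : Type*} [MeasurableSpace X]
    (H : Set (X → Bool)) (hmeas : ∀ h ∈ H, Measurable h) (hVC : SSL.FiniteVCDim H)
    (𝓟 : Set (ProbabilityMeasure (X × Bool)))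
    (hclass : ∀ P ∈ 𝓟, SSL.IsMeasurableClass H (SSL.marginal P))
    (hrich : SSL.IsRich 𝓟 H) :
    ¬ SSL.MarginalHelps H 𝓟 ∧
      SSL.HasRate (SSL.minimaxSL H 𝓟) (fun ℓ => 1 / Real.sqrt ℓ) ∧
      SSL.HasRate (SSL.minimaxMarginal H 𝓟) (fun ℓ => 1 / Real.sqrt ℓ) := by
  have hH : H.Nonempty := by
    obtain ⟨h, hh, -⟩ := hrich
    exact ⟨h, hh⟩
  obtain ⟨C, hC, hupper⟩ := SSL.exists_minimaxSL_le hmeas hVC hH hclass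
  obtain ⟨c, hc, hlower⟩ := SSL.exists_le_minimaxMarginal hmeas hrich
  have hle := SSL.minimaxMarginal_le_minimaxSL H 𝓟
  exact ⟨SSL.not_tendsto_div_zero_of_hasRate hc hC hlower hupper,
    ⟨c, C, hc, hC, fun ℓ hℓ => ⟨(hlower ℓ hℓ).trans (hle ℓ), hupper ℓ hℓ⟩⟩,
    ⟨c, C, hc, hC, fun ℓ hℓ => ⟨hlower ℓ hℓ, (hle ℓ).trans (hupper ℓ hℓ)⟩⟩⟩
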